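/- Let $M$ be a smooth (finite-dimensional, Hausdorff, second countable) manifold and let $(E_{-1},E_0,\partial,\rho,S,\diamond,\Omega)$ be a $\mathrm{CLWX}$ 2-algebroid over $M$: smooth vector bundles $E_{-1},E_0$ of finite rank, a smooth nondegenerate symmetric bilinear form $S$ on $\mathcal E=E_{-1}\oplus E_0$ for which $E_{-1}$ and $E_0$ are isotropic, bundle maps $\partial:E_{-1}\to E_0$ and $\rho:E_0\to TM$, a bilinear operation $\diamond:\Gamma(E_{-i})\times\Gamma(E_{-j})\to\Gamma(E_{-(i+j)})$ ($0\le i+j\le1$) that is skew-symmetric on $\Gamma(E_0)$, and a $3$-form $\Omega:\wedge^3E_0\to E_{-1}$, such that (i) $(\Gamma(E_{-1}),\Gamma(E_0),\partial,\diamond,\Omega)$ is a Leibniz 2-algebra (a 2-term homotopy Leibniz algebra: with $l_2=\diamond$, $l_3=\Omega$, for $w,x,y,z\in\Gamma(E_0)$ and $m,p\in\Gamma(E_{-1})$ one has $\partial(x\diamond m)=x\diamond\partial m$, $\partial(m\diamond x)=\partial m\diamond x$, $\partial m\diamond p=m\diamond\partial p$; the expression $x\diamond(y\diamond z)-(x\diamond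 y)\diamond z-y\diamond(x\diamond z)$ equals $\partial\Omega(x,y,z)$, and if one of its arguments is replaced by $m$ it equals $\Omega$ with that argument replaced by $\partial m$; and $w\diamond\Omega(x,y,z)-x\diamond\Omega(w,y,z)+y\diamond\Omega(w,x,z)+\Omega(w,x,y)\diamond z-\Omega(w\diamond x,y,z)-\Omega(x,w\diamond y,z)-\Omega(x,y,w\diamond z)+\Omega(w,x\diamond y,z)+\Omega(w,y,x\diamond z)-\Omega(w,x,y\diamond z)=0$); (ii) $e\diamond e=\frac12\mathcal D S(e,e)$ for $e\in\Gamma(\mathcal E)$, where $S(\mathcal Df,e^0)=\rho(e^0)(f)$; (iii) $S(\partial a,b)=S(a,\partial b)$ for $a,b\in\Gamma(E_{-1})$; (iv) $\rho(e_1)S(e_2,e_3)=S(e_1\diamond e_2,e_3)+S(e_2,e_1\diamond e_3)$ for $e_i\in\Gamma(\mathcal E)$ (with $\rho=0$ on $E_{-1}$); (v) $S(\Omega(e_1,e_2,e_3),e_4)=-S(e_3,\Omega(e_1,e_2,e_4))$ for $e_i\in\Gamma(E_0)$. Define $\rho^*:T^*M\to E_{-1}$ by $S(\rho^*(\alpha),e^0)=\langle\alpha,\rho(e^0)\rangle$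 and assume that the $\mathrm{CLWX}$ 2-algebroid is exact, i.e. that $$0\to T^*M\xrightarrow{\rho^*}E_{-1}\xrightarrow{\partial}E_0\xrightarrow{\rho}TM\to0$$ is an exact sequence of vector bundles. Then the family of quotient spaces $F_{-1}=E_{-1}/\rho^*(T^*M)$ carries a smooth vector bundle structure for which the projection $\mathrm{pr}:E_{-1}\to F_{-1}$ is a smooth bundle map, every section $m$ of $F_{-1}$ has a lift $\widetilde m\in\Gamma(E_{-1})$, $\mathrm{pr}(\widetilde m)=m$, and, for any such structure, the formulas $$l_1(m)=\partial\widetilde m,\quad l_2(e^0_1,e^0_2)=e^0_1\diamond e^0_2,\quad l_2(e^0,m)=\mathrm{pr}(e^0\diamond\widetilde m),\quad l_2(m,e^0)=\mathrm{pr}(\widetilde m\diamond e^0),\quad l_3(e^0_1,e^0_2,e^0_3)=\mathrm{pr}\,\Omega(e^0_1,e^0_2,e^0_3)$$ for $e^0,e^0_i\in\Gamma(E_0)$, $m\in\Gamma(F_{-1})$, and $$\mathcal S(u,m)=S(u,\widetilde m),\qquad u\in\Gamma(\ker\rho),$$ do not depend on the choice of the lifts and make $(F_{-1}\oplus E_0;\rho,l_1,l_2,l_3)$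 with $\mathcal S$ a quadratic Lie 2-algebroid. That is: $l_1$, $l_3$ are $C^\infty(M)$-linear; $(\Gamma(F_{-1})\oplus\Gamma(E_0);l_1,l_2,l_3)$ is a Lie 2-algebra (a Leibniz 2-algebra with skew-symmetric $l_2$ and $l_3$); $l_2(e^0,fY)=f\,l_2(e^0,Y)+\rho(e^0)(f)Y$ for $f\in C^\infty(M)$ and $Y$ a section of $F_{-1}$ or $E_0$; $\rho$ is surjective; and $\mathcal S$ is a smooth nondegenerate pairing of $F_{-1}$ with $\ker\rho$ such that $$\mathcal S(l_1(m),p)=\mathcal S(m,l_1(p)),\quad \rho(e^0)\mathcal S(u,m)=\mathcal S(l_2(e^0,u),m)+\mathcal S(u,l_2(e^0,m)),\quad \mathcal S(l_3(e^0_1,e^0_2,u),v)=-\mathcal S(l_3(e^0_1,e^0_2,v),u)$$ for $m,p\in\Gamma(F_{-1})$, $u,v\in\Gamma(\ker\rho)$, $e^0,e^0_1,e^0_2\in\Gamma(E_0)$. Consequently the exact $\mathrm{CLWX}$ 2-algebroid is an extension of this quadratic Lie 2-algebroid by $T^*[1]M$: the diagram of smooth bundle maps $$\begin{array}{ccccccccc}0&\to&T^*M&\xrightarrow{\rho^*}&E_{-1}&\xrightarrow{\mathrm{pr}}&F_{-1}&\to&0\\&&{\scriptstyle0}\downarrow&&{\scriptstyle\partial}\downarrow&&{\scriptstyle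 l_1}\downarrow&&\\0&\to&0&\to&E_0&\xrightarrow{\mathrm{id}}&E_0&\to&0\end{array}$$ commutes and has exact rows. -/

import Mathlib

open Bundle Manifold
open scoped ContDiff

noncomputable section

/-! ### Leibniz 2-algebras and Lie 2-algebras (over `ℝ`) -/

/-- A Leibniz 2-algebra on the two-term complex `d : V1 → V0` (`V1` in degree `-1`, `V0` in
degree `0`). The bracket `l₂` has the three components `l00`, `l01`, `l10`. -/
structure Leibniz2Algebra (V1 V0 : Type*) [AddCommGroup V1] [Module ℝ V1]
    [AddCommGroup V0] [Module ℝ V0] where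
  d : V1 →ₗ[ℝ] V0
  l00 : V0 →ₗ[ℝ] V0 →ₗ[ℝ] V0
  l01 : V0 →ₗ[ℝ] V1 →ₗ[ℝ] V1
  l10 : V1 →ₗ[ℝ] V0 →ₗ[ℝ] V1
  l3 : V0 →ₗ[ℝ] V0 →ₗ[ℝ] V0 →ₗ[ℝ] V1
  d_l01 : ∀ x m, d (l01 x m) = l00 x (d m)
  d_l10 : ∀ m x, d (l10 m x) = l00 (d m) x
  l01_d : ∀ m n, l01 (d m) n = l10 m (d n)
  d_l3 : ∀ x y z, d (l3 x y z) = l00 x (l00 y z) - l00 (l00 x y) z - l00 y (l00 x z)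
  l3_d₃ : ∀ x y m, l3 x y (d m) = l01 x (l01 y m) - l01 (l00 x y) m - l01 y (l01 x m)
  l3_d₂ : ∀ x m y, l3 x (d m) y = l01 x (l10 m y) - l10 (l01 x m) y - l10 m (l00 x y)
  l3_d₁ : ∀ m x y, l3 (d m) x y = l10 m (l00 x y) - l10 (l10 m x) y - l01 x (l10 m y)
  jacobiator : ∀ w x y z,
    l01 w (l3 x y z) - l01 x (l3 w y z) + l01 y (l3 w x z) + l10 (l3 w x y) z
      - l3 (l00 w x) y z - l3 x (l00 w y) z - l3 x y (l00 w z)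
      + l3 w (l00 x y) z + l3 w y (l00 x z) - l3 w x (l00 y z) = 0

/-- A Lie 2-algebra: a Leibniz 2-algebra whose brackets `l₂` and `l₃` are skew-symmetric. -/
structure Lie2Algebra (V1 V0 : Type*) [AddCommGroup V1] [Module ℝ V1]
    [AddCommGroup V0] [Module ℝ V0] extends Leibniz2Algebra V1 V0 where
  skew00 : ∀ x y, l00 x y = -l00 y x
  skew01 : ∀ x m, l01 x m = -l10 m x
  skew3_left : ∀ x y z, l3 x y z = -l3 y x z
  skew3_right : ∀ x y z, l3 x y z = -l3 x z y

/-! ### Smooth vector bundles -/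

/-- A smooth real vector bundle of finite rank over the `n`-dimensional manifold `M`. -/
structure SmoothVB (n : ℕ) (M : Type*) [TopologicalSpace M]
    [ChartedSpace (EuclideanSpace ℝ (Fin n)) M] where
  Model : Type*
  [normedModel : NormedAddCommGroup Model]
  [spaceModel : NormedSpace ℝ Model]
  [finModel : FiniteDimensional ℝ Model]
  Fiber : M → Type*
  [addFiber : ∀ x, AddCommGroup (Fiber x)]
  [modFiber : ∀ x, Module ℝ (Fiber x)]
  [topFiber : ∀ x, TopologicalSpace (Fiber x)]
  [topTotal : TopologicalSpace (TotalSpace Model Fiber)]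
  [fiberBundle : FiberBundle Model Fiber]
  [vectorBundle : VectorBundle ℝ Model Fiber]
  [smoothBundle : ContMDiffVectorBundle ∞ Model Fiber (𝓡 n)]

attribute [instance] SmoothVB.normedModel SmoothVB.spaceModel SmoothVB.finModel
  SmoothVB.addFiber SmoothVB.modFiber SmoothVB.topFiber SmoothVB.topTotal
  SmoothVB.fiberBundle SmoothVB.vectorBundle SmoothVB.smoothBundle

section

variable {n : ℕ} {M : Type*} [TopologicalSpace M] [ChartedSpace (EuclideanSpace ℝ (Fin n)) M]

/-- The space `Γ(E)` of smooth sections. -/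
abbrev SmoothVB.Sec (E : SmoothVB n M) : Type _ := ContMDiffSection (𝓡 n) E.Model ∞ E.Fiber

/-- The product `f • s` of a smooth function and a smooth section. -/
def SmoothVB.fsmul (E : SmoothVB n M) (f : C^∞⟮𝓡 n, M; ℝ⟯) (s : E.Sec) : E.Sec where
  toFun := fun x => f x • s x
  contMDiff_toFun := f.contMDiff.smul_section s.contMDiff

/-- The cotangent space, written as the fibre of the bundle `Hom(TM, ℝ)`. -/
abbrev CotSpace (n : ℕ) {M : Type*} [TopologicalSpace M]
    [ChartedSpace (EuclideanSpace ℝ (Fin n)) M] (x : M) : Type :=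
  TangentSpace (𝓡 n) x →L[ℝ] Bundle.Trivial M ℝ x

/-- The differential `df` at `x`. -/
def differential (n : ℕ) {M : Type*} [TopologicalSpace M]
    [ChartedSpace (EuclideanSpace ℝ (Fin n)) M] (f : M → ℝ) (x : M) : CotSpace n x :=
  mfderiv (𝓡 n) 𝓘(ℝ, ℝ) f x

/-- A family of linear maps between the fibres of two vector bundles over `M` is a smooth bundle
map: the induced map of total spaces is smooth. -/
def IsSmoothBundleMap (n : ℕ) {M : Type*} [TopologicalSpace M]
    [ChartedSpace (EuclideanSpace ℝ (Fin n)) M]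
    (F : Type*) [NormedAddCommGroup F] [NormedSpace ℝ F] (V : M → Type*)
    [∀ x, AddCommGroup (V x)] [∀ x, Module ℝ (V x)] [∀ x, TopologicalSpace (V x)]
    [TopologicalSpace (TotalSpace F V)] [FiberBundle F V]
    (F' : Type*) [NormedAddCommGroup F'] [NormedSpace ℝ F'] (V' : M → Type*)
    [∀ x, AddCommGroup (V' x)] [∀ x, Module ℝ (V' x)] [∀ x, TopologicalSpace (V' x)]
    [TopologicalSpace (TotalSpace F' V')] [FiberBundle F' V']
    (φ : ∀ x, V x →ₗ[ℝ] V' x) : Prop :=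
  ContMDiff ((𝓡 n).prod 𝓘(ℝ, F)) ((𝓡 n).prod 𝓘(ℝ, F')) ∞
    (fun p : TotalSpace F V => (⟨p.1, φ p.1 p.2⟩ : TotalSpace F' V'))

end

/-! ### CLWX 2-algebroids -/

/-- A CLWX 2-algebroid on `E_{-1} ⊕ E_0` (here `E1` and `E0`).

Since `E_{-1}` and `E_0` are isotropic, the symmetric bilinear form on `E_{-1} ⊕ E_0` is
`(a + x, b + y) ↦ S(a, y) + S(b, x)` for a pairing `S` of `E_{-1}` with `E_0`, and it is
nondegenerate iff the pairing is. The components `l00`, `l01`, `l10` of `leib` are those of the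
operation `⋄`; the axioms on sections of `E_{-1} ⊕ E_0` are spelled out on homogeneous components
(with `ρ` zero on `E_{-1}` and `Γ(E_{-1}) ⋄ Γ(E_{-1}) = 0`; the components left out read `0 = 0`). -/
structure CLWX {n : ℕ} {M : Type*} [TopologicalSpace M]
    [ChartedSpace (EuclideanSpace ℝ (Fin n)) M] [IsManifold (𝓡 n) ∞ M]
    (E1 E0 : SmoothVB n M) where
  /-- the pairing -/
  S : ∀ x, E1.Fiber x →ₗ[ℝ] E0.Fiber x →ₗ[ℝ] ℝ
  S_smooth : ∀ (a : E1.Sec) (e : E0.Sec),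
    ContMDiff (𝓡 n) 𝓘(ℝ, ℝ) ∞ (fun x => S x (a x) (e x))
  S_nondegenerate : ∀ x, (S x).Nondegenerate
  /-- the bundle map `∂` -/
  bd : ∀ x, E1.Fiber x →ₗ[ℝ] E0.Fiber x
  bd_smooth : IsSmoothBundleMap n E1.Model E1.Fiber E0.Model E0.Fiber bd
  /-- the anchor -/
  rho : ∀ x, E0.Fiber x →ₗ[ℝ] TangentSpace (𝓡 n) x
  rho_smooth : IsSmoothBundleMap n E0.Model E0.Fiber (EuclideanSpace ℝ (Fin n))
    (fun x : M => TangentSpace (𝓡 n) x) rho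
  /-- the `E_{-1}`-valued `3`-form on `E_0` (smooth, since `leib.l3` takes values in the smooth
  sections) -/
  Om : ∀ x, E0.Fiber x [⋀^Fin 3]→ₗ[ℝ] E1.Fiber x
  /-- axiom (i) -/
  leib : Leibniz2Algebra E1.Sec E0.Sec
  leib_d : ∀ (a : E1.Sec) x, leib.d a x = bd x (a x)
  leib_l3 : ∀ (e₁ e₂ e₃ : E0.Sec) x, leib.l3 e₁ e₂ e₃ x = Om x ![e₁ x, e₂ x, e₃ x]
  /-- `⋄` is skew-symmetric on `Γ(E_0)` -/
  skew : ∀ e₁ e₂ : E0.Sec, leib.l00 e₁ e₂ = -leib.l00 e₂ e₁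
  /-- axiom (ii), `e ⋄ e = ½ 𝒟 S(e,e)`, at `e = a + e₀`, where `S(e,e) = 2 S(a,e₀)` and `𝒟 f` is
  characterized by `S(𝒟 f, y) = ρ(y)(f)`; its `E_0`-component `e₀ ⋄ e₀ = 0` is in `skew` -/
  symm_part : ∀ (a : E1.Sec) (e₀ : E0.Sec) (x : M) (y : E0.Fiber x),
    S x ((leib.l01 e₀ a + leib.l10 a e₀) x) y
      = differential n (fun p => S p (a p) (e₀ p)) x (rho x y)
  /-- axiom (iii) -/
  bd_symm : ∀ (a b : E1.Sec) x, S x (b x) (bd x (a x)) = S x (a x) (bd x (b x))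
  /-- axiom (iv), `e₁ = e ∈ Γ(E_0)` -/
  invariant0 : ∀ (e y : E0.Sec) (a : E1.Sec) (x : M),
    differential n (fun p => S p (a p) (y p)) x (rho x (e x))
      = S x (leib.l01 e a x) (y x) + S x (a x) (leib.l00 e y x)
  /-- axiom (iv), `e₁ = a ∈ Γ(E_{-1})` -/
  invariant1 : ∀ (a : E1.Sec) (y z : E0.Sec) (x : M),
    0 = S x (leib.l10 a y x) (z x) + S x (leib.l10 a z x) (y x)
  /-- axiom (v) -/
  Om_skew : ∀ (e₁ e₂ e₃ e₄ : E0.Sec) (x : M),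
    S x (Om x ![e₁ x, e₂ x, e₃ x]) (e₄ x) = -S x (Om x ![e₁ x, e₂ x, e₄ x]) (e₃ x)

namespace CLWX

variable {n : ℕ} {M : Type*} [TopologicalSpace M] [ChartedSpace (EuclideanSpace ℝ (Fin n)) M]
  [IsManifold (𝓡 n) ∞ M] {E1 E0 : SmoothVB n M}

theorem S_isPerfPair (𝓔 : CLWX E1 E0) (x : M) : (𝓔.S x).IsPerfPair := by
  have : FiniteDimensional ℝ (E1.Fiber x) := VectorBundle.finiteDimensional ℝ E1.Model E1.Fiber x
  obtain ⟨h1, h2⟩ := 𝓔.S_nondegenerate x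
  refine LinearMap.IsPerfPair.of_injective ?_ ?_
  · rw [injective_iff_map_eq_zero]
    exact fun a ha => h1 a fun y => by rw [ha, LinearMap.zero_apply]
  · rw [injective_iff_map_eq_zero]
    exact fun y hy => h2 y fun a => by rw [← LinearMap.flip_apply, hy, LinearMap.zero_apply]

/-- The map `ρ* : T*M → E_{-1}`, defined by `S(ρ*(α), e) = ⟨α, ρ(e)⟩`. -/
def rhoStar (𝓔 : CLWX E1 E0) (x : M) : CotSpace n x →ₗ[ℝ] E1.Fiber x :=
  have := 𝓔.S_isPerfPair x
  { toFun := fun α => (𝓔.S x).toPerfPair.symm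
      ((α : TangentSpace (𝓡 n) x →ₗ[ℝ] ℝ) ∘ₗ 𝓔.rho x)
    map_add' := fun α β => by
      rw [← map_add]; rfl
    map_smul' := fun c α => by
      rw [RingHom.id_apply, ← map_smul]; rfl }

theorem S_rhoStar (𝓔 : CLWX E1 E0) (x : M) (α : CotSpace n x) (e : E0.Fiber x) :
    𝓔.S x (𝓔.rhoStar x α) e = α (𝓔.rho x e) := by
  have := 𝓔.S_isPerfPair x
  have := LinearMap.apply_symm_toPerfPair_self (p := 𝓔.S x)
    ((α : TangentSpace (𝓡 n) x →ₗ[ℝ] ℝ) ∘ₗ 𝓔.rho x)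
  exact congrArg (fun g => g e) this

/-- Exactness: `0 → T*M → E_{-1} → E_0 → TM → 0` (with maps `ρ*`, `∂`, `ρ`) is an exact sequence. -/
structure IsExact (𝓔 : CLWX E1 E0) : Prop where
  injective : ∀ x, Function.Injective (𝓔.rhoStar x)
  exact_E1 : ∀ x, Function.Exact (𝓔.rhoStar x) (𝓔.bd x)
  exact_E0 : ∀ x, Function.Exact (𝓔.bd x) (𝓔.rho x)
  surjective : ∀ x, Function.Surjective (𝓔.rho x)

end CLWX

/-! ### Quadratic Lie 2-algebroids -/

/-- A (split) Lie 2-algebroid on `A_{-1} ⊕ A_0` (here `A1` and `A0`). The brackets `l₁`, `l₃` are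
`C^∞(M)`-linear, that is, induced by the bundle maps `l1`, `l3`. -/
structure Lie2Algebroid {n : ℕ} {M : Type*} [TopologicalSpace M]
    [ChartedSpace (EuclideanSpace ℝ (Fin n)) M] [IsManifold (𝓡 n) ∞ M]
    (A1 A0 : SmoothVB n M) where
  /-- the anchor -/
  rho : ∀ x, A0.Fiber x →ₗ[ℝ] TangentSpace (𝓡 n) x
  rho_smooth : IsSmoothBundleMap n A0.Model A0.Fiber (EuclideanSpace ℝ (Fin n))
    (fun x : M => TangentSpace (𝓡 n) x) rho
  l1 : ∀ x, A1.Fiber x →ₗ[ℝ] A0.Fiber x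
  l1_smooth : IsSmoothBundleMap n A1.Model A1.Fiber A0.Model A0.Fiber l1
  l3 : ∀ x, A0.Fiber x [⋀^Fin 3]→ₗ[ℝ] A1.Fiber x
  /-- the Lie 2-algebra of sections -/
  lie : Lie2Algebra A1.Sec A0.Sec
  lie_d : ∀ (m : A1.Sec) x, lie.d m x = l1 x (m x)
  lie_l3 : ∀ (e₁ e₂ e₃ : A0.Sec) x, lie.l3 e₁ e₂ e₃ x = l3 x ![e₁ x, e₂ x, e₃ x]
  /-- Leibniz rule on `A_0` -/
  leibniz0 : ∀ (e y : A0.Sec) (f : C^∞⟮𝓡 n, M; ℝ⟯) (x : M),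
    lie.l00 e (A0.fsmul f y) x = f x • lie.l00 e y x + differential n f x (rho x (e x)) • y x
  /-- Leibniz rule on `A_{-1}` -/
  leibniz1 : ∀ (e : A0.Sec) (m : A1.Sec) (f : C^∞⟮𝓡 n, M; ℝ⟯) (x : M),
    lie.l01 e (A1.fsmul f m) x = f x • lie.l01 e m x + differential n f x (rho x (e x)) • m x

/-- A quadratic Lie 2-algebroid: a transitive Lie 2-algebroid with a smooth nondegenerate graded
symmetric bilinear form of degree `1` on `A_{-1} ⊕ ker ρ`, that is, a pairing `Q` of `A_{-1}` with
`ker ρ`, which is invariant. Sections of `ker ρ` are the sections of `A_0` killed by `ρ`; each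
invariance condition includes that the elements it pairs do lie in `ker ρ`. -/
structure QuadraticLie2Algebroid {n : ℕ} {M : Type*} [TopologicalSpace M]
    [ChartedSpace (EuclideanSpace ℝ (Fin n)) M] [IsManifold (𝓡 n) ∞ M]
    (A1 A0 : SmoothVB n M) extends Lie2Algebroid A1 A0 where
  transitive : ∀ x, Function.Surjective (rho x)
  /-- the pairing -/
  Q : ∀ x, A1.Fiber x →ₗ[ℝ] LinearMap.ker (rho x) →ₗ[ℝ] ℝ
  Q_smooth : ∀ (m : A1.Sec) (u : A0.Sec) (hu : ∀ x, u x ∈ LinearMap.ker (rho x)),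
    ContMDiff (𝓡 n) 𝓘(ℝ, ℝ) ∞ (fun x => Q x (m x) ⟨u x, hu x⟩)
  Q_nondegenerate : ∀ x, (Q x).Nondegenerate
  Q_l1 : ∀ (m p : A1.Sec) (x : M),
    ∃ (hm : l1 x (m x) ∈ LinearMap.ker (rho x)) (hp : l1 x (p x) ∈ LinearMap.ker (rho x)),
      Q x (p x) ⟨l1 x (m x), hm⟩ = Q x (m x) ⟨l1 x (p x), hp⟩
  Q_l2 : ∀ (e u : A0.Sec) (hu : ∀ x, u x ∈ LinearMap.ker (rho x)) (m : A1.Sec) (x : M),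
    ∃ h : lie.l00 e u x ∈ LinearMap.ker (rho x),
      differential n (fun p => Q p (m p) ⟨u p, hu p⟩) x (rho x (e x))
        = Q x (m x) ⟨lie.l00 e u x, h⟩ + Q x (lie.l01 e m x) ⟨u x, hu x⟩
  Q_l3 : ∀ (e₁ e₂ u v : A0.Sec) (hu : ∀ x, u x ∈ LinearMap.ker (rho x))
    (hv : ∀ x, v x ∈ LinearMap.ker (rho x)) (x : M),
    Q x (l3 x ![e₁ x, e₂ x, u x]) ⟨v x, hv x⟩ = -Q x (l3 x ![e₁ x, e₂ x, v x]) ⟨u x, hu x⟩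

/-! ### Quotient bundles -/

/-- A smooth vector bundle structure on the family of quotient spaces `E_x / K_x` for which the
projection from `E` is a smooth bundle map. (There is at most one such smooth structure, and there
is one iff `K` is a smooth subbundle of constant rank.) -/
structure QuotientBundle {n : ℕ} {M : Type*} [TopologicalSpace M]
    [ChartedSpace (EuclideanSpace ℝ (Fin n)) M]
    (E : SmoothVB n M) (K : ∀ x, Submodule ℝ (E.Fiber x)) where
  Model : Type*
  [normedModel : NormedAddCommGroup Model]
  [spaceModel : NormedSpace ℝ Model]
  [finModel : FiniteDimensional ℝ Model]
  [topTotal : TopologicalSpace (TotalSpace Model (fun x => E.Fiber x ⧸ K x))]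
  [fiberBundle : FiberBundle Model (fun x => E.Fiber x ⧸ K x)]
  [vectorBundle : VectorBundle ℝ Model (fun x => E.Fiber x ⧸ K x)]
  [smoothBundle : ContMDiffVectorBundle ∞ Model (fun x => E.Fiber x ⧸ K x) (𝓡 n)]
  smooth_proj : IsSmoothBundleMap n E.Model E.Fiber Model (fun x => E.Fiber x ⧸ K x)
    (fun x => (K x).mkQ)

namespace QuotientBundle

variable {n : ℕ} {M : Type*} [TopologicalSpace M] [ChartedSpace (EuclideanSpace ℝ (Fin n)) M]
  {E : SmoothVB n M} {K : ∀ x, Submodule ℝ (E.Fiber x)}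

/-- The quotient as a smooth vector bundle. -/
def toVB (B : QuotientBundle E K) : SmoothVB n M :=
  letI := B.normedModel
  letI := B.spaceModel
  letI := B.finModel
  letI := B.topTotal
  letI := B.fiberBundle
  letI := B.vectorBundle
  letI := B.smoothBundle
  { Model := B.Model
    Fiber := fun x => E.Fiber x ⧸ K x }

/-- The projection `pr : E → E/K`. -/
def pr (B : QuotientBundle E K) (x : M) : E.Fiber x →ₗ[ℝ] B.toVB.Fiber x := (K x).mkQ

end QuotientBundle

/-! ### The ample Lie 2-algebroid and CLWX-extensions -/

section

variable {n : ℕ} {M : Type*} [TopologicalSpace M] [ChartedSpace (EuclideanSpace ℝ (Fin n)) M]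
  [IsManifold (𝓡 n) ∞ M] {E1 E0 F1 : SmoothVB n M}

/-- The structure `𝓐` on `F_{-1} ⊕ E_0` is the one induced by `𝓔` along `pr : E_{-1} → F_{-1}`:
same anchor, `l₁(m) = ∂ m̃`, `l₂(e,e') = e ⋄ e'`, `l₂(e,m) = pr(e ⋄ m̃)`, `l₂(m,e) = pr(m̃ ⋄ e)`,
`l₃ = pr Ω` and `𝒮(u,m) = S(u,m̃)`, for every lift `m̃` of `m`. -/
structure IsInducedBy (𝓐 : QuadraticLie2Algebroid F1 E0) (𝓔 : CLWX E1 E0)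
    (pr : ∀ x, E1.Fiber x →ₗ[ℝ] F1.Fiber x) : Prop where
  rho_eq : 𝓐.rho = 𝓔.rho
  /-- every section of `F_{-1}` has a lift -/
  exists_lift : ∀ m : F1.Sec, ∃ m' : E1.Sec, ∀ x, pr x (m' x) = m x
  l1_eq : ∀ (m : F1.Sec) (m' : E1.Sec), (∀ x, pr x (m' x) = m x) →
    ∀ x, 𝓐.l1 x (m x) = 𝓔.bd x (m' x)
  l00_eq : ∀ e₁ e₂ : E0.Sec, 𝓐.lie.l00 e₁ e₂ = 𝓔.leib.l00 e₁ e₂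
  l01_eq : ∀ (e : E0.Sec) (m : F1.Sec) (m' : E1.Sec), (∀ x, pr x (m' x) = m x) →
    ∀ x, 𝓐.lie.l01 e m x = pr x (𝓔.leib.l01 e m' x)
  l10_eq : ∀ (m : F1.Sec) (e : E0.Sec) (m' : E1.Sec), (∀ x, pr x (m' x) = m x) →
    ∀ x, 𝓐.lie.l10 m e x = pr x (𝓔.leib.l10 m' e x)
  l3_eq : ∀ (e₁ e₂ e₃ : E0.Sec) (x : M),
    𝓐.l3 x ![e₁ x, e₂ x, e₃ x] = pr x (𝓔.Om x ![e₁ x, e₂ x, e₃ x])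
  Q_eq : ∀ (m : F1.Sec) (m' : E1.Sec), (∀ x, pr x (m' x) = m x) →
    ∀ (x : M) (u : LinearMap.ker (𝓐.rho x)), 𝓐.Q x (m x) u = 𝓔.S x (m' x) u

/-- `𝓔` is an extension of `𝓐` by `T*[1]M`: the diagram with rows
`0 → T*M → E_{-1} → F_{-1} → 0` (maps `ρ*` and `pr`) and `0 → 0 → E_0 = E_0 → 0` and with columns
`0`, `∂`, `l₁` consists of smooth bundle maps, commutes and has exact rows. -/
structure IsExtensionByCotangent (𝓔 : CLWX E1 E0) (𝓐 : QuadraticLie2Algebroid F1 E0)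
    (pr : ∀ x, E1.Fiber x →ₗ[ℝ] F1.Fiber x) : Prop where
  rhoStar_smooth : IsSmoothBundleMap n (EuclideanSpace ℝ (Fin n) →L[ℝ] ℝ)
    (fun x : M => CotSpace n x) E1.Model E1.Fiber 𝓔.rhoStar
  pr_smooth : IsSmoothBundleMap n E1.Model E1.Fiber F1.Model F1.Fiber pr
  rhoStar_injective : ∀ x, Function.Injective (𝓔.rhoStar x)
  exact : ∀ x, Function.Exact (𝓔.rhoStar x) (pr x)
  pr_surjective : ∀ x, Function.Surjective (pr x)
  bd_rhoStar : ∀ x α, 𝓔.bd x (𝓔.rhoStar x α) = 0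
  l1_pr : ∀ x a, 𝓐.l1 x (pr x a) = 𝓔.bd x a

end

end

/-! Exactness at `E_{-1}` says that im ρ* = ker ∂. So `F_{-1}` is the quotient of `E_{-1}` by the
kernel of a bundle map of constant rank, and every claim reduces to how the operations and the
pairing treat ker ∂.

Algebra: ∂(x ⋄ m) = x ⋄ ∂m and ∂(m ⋄ x) = ∂m ⋄ x show that sections of ker ∂ are stable under ⋄ with
Γ(E_0), so the Leibniz 2-algebra descends to the quotient (`quotientLie`). Since ρ is onto, the
annihilator of ker ρ in `E_{-1}` is im ρ* (`IsExact.mem_range_rhoStar`). By axiom (ii) the symmetric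
part of ⋄ lies in this annihilator, so it dies in the quotient and the bracket becomes skew. The
same duality makes 𝒮 well defined and nondegenerate. Invariance of `S` together with its
nondegeneracy yields the Leibniz rules (`l01_fsmul`, `l00_fsmul`) and the fact that ker ρ is an
ideal (`IsExact.rho_l00`).

Analysis: inverting matrices in local trivializations gives the smooth structure on the quotient
(`SmoothVB.nonempty_quotientBundle`), local lifts of sections, glued by convexity
(`exists_lift_of_surjective`), and the smoothness of ρ* (`contMDiff_of_pairing`). -/

noncomputable section

open scoped Topology
open Topology (IsInducing)

universe w

/-! ### Smooth bundle maps tested on global sections -/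

section

variable {n : ℕ} {M : Type*} [TopologicalSpace M] [ChartedSpace (EuclideanSpace ℝ (Fin n)) M]

/-- A family of continuous linear maps on a finite-dimensional space is smooth if it is smooth on
each vector. -/
theorem contMDiffAt_clm_of_apply {F G : Type*} [NormedAddCommGroup F] [NormedSpace ℝ F]
    [FiniteDimensional ℝ F] [NormedAddCommGroup G] [NormedSpace ℝ G] {f : M → F →L[ℝ] G} {x : M}
    (h : ∀ v, ContMDiffAt (𝓡 n) 𝓘(ℝ, G) ∞ (fun y => f y v) x) :
    ContMDiffAt (𝓡 n) 𝓘(ℝ, F →L[ℝ] G) ∞ f x := by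
  let b := Module.finBasis ℝ F
  -- Expansion in a basis: `f` is a finite sum of fixed continuous linear maps applied to the
  -- functions `y ↦ f y (b i)`.
  have hf : f = fun y => ∑ i, ContinuousLinearMap.smulRightL ℝ F G
      (LinearMap.toContinuousLinearMap (b.coord i)) (f y (b i)) := by
    funext y
    ext v
    conv_lhs => rw [← b.sum_repr v, map_sum]
    simp
  rw [hf]
  refine contMDiffAt_finsetSum fun i _ => ?_
  exact (ContinuousLinearMap.contMDiff _).contMDiffAt.comp x (h (b i))

namespace SmoothVB

/-- The preferred trivialization at a point. -/
abbrev triv (E : SmoothVB n M) (x₀ : M) : Trivialization E.Model (π E.Model E.Fiber) :=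
  trivializationAt E.Model E.Fiber x₀

theorem contMDiffOn_triv_symm (E : SmoothVB n M) (x₀ : M) (v : E.Model) :
    ContMDiffOn (𝓡 n) ((𝓡 n).prod 𝓘(ℝ, E.Model)) ∞
      (fun x => TotalSpace.mk' E.Model x ((E.triv x₀).symm x v)) (E.triv x₀).baseSet := by
  rw [(E.triv x₀).contMDiffOn_section_baseSet_iff]
  refine contMDiffOn_const (c := v) |>.congr fun x hx => ?_
  rw [(E.triv x₀).apply_mk_symm hx]

/-- A smooth local section agrees near a given point with a global one. -/
theorem exists_sec_eventuallyEq [T2Space M] [IsManifold (𝓡 n) ∞ M] (E : SmoothVB n M)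
    {s : ∀ x, E.Fiber x} {U : Set M}
    (hU : IsOpen U) (hs : ContMDiffOn (𝓡 n) ((𝓡 n).prod 𝓘(ℝ, E.Model)) ∞
      (fun x => TotalSpace.mk' E.Model x (s x)) U) {x : M} (hx : x ∈ U) :
    ∃ t : E.Sec, ∀ᶠ y in 𝓝 x, t y = s y := by
  -- The topological support of the bump function lies in `U`, so its product with `s` is smooth on
  -- all of `M`.
  obtain ⟨f, -, hf⟩ := (SmoothBumpFunction.nhds_basis_tsupport (I := 𝓡 n) x).mem_iff.1
    (hU.mem_nhds hx)
  refine ⟨⟨_,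
    ContMDiffOn.smul_section_of_tsupport f.contMDiff.contMDiffOn hU hf hs⟩, ?_⟩
  filter_upwards [f.eventuallyEq_one] with y hy
  change f y • s y = s y
  rw [hy, Pi.one_apply, one_smul]

/-- Globalizes the vectors of a local frame, so that hypotheses on global sections control
coordinate expressions. -/
theorem exists_sec_eventuallyEq_triv_symm [T2Space M] [IsManifold (𝓡 n) ∞ M] (E : SmoothVB n M)
    {x₀ x : M} (hx : x ∈ (E.triv x₀).baseSet) (v : E.Model) :
    ∃ t : E.Sec, ∀ᶠ y in 𝓝 x, t y = (E.triv x₀).symm y v :=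
  E.exists_sec_eventuallyEq (E.triv x₀).open_baseSet (E.contMDiffOn_triv_symm x₀ v) hx

theorem exists_sec_apply_eq [T2Space M] [IsManifold (𝓡 n) ∞ M] (E : SmoothVB n M) (x : M)
    (v : E.Fiber x) : ∃ t : E.Sec, t x = v := by
  have hx := FiberBundle.mem_baseSet_trivializationAt' (F := E.Model) (E := E.Fiber) x
  obtain ⟨t, ht⟩ := E.exists_sec_eventuallyEq_triv_symm hx ((E.triv x).linearMapAt ℝ x v)
  exact ⟨t, by rw [ht.self_of_nhds, (E.triv x).symm_linearMapAt hx]⟩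

variable {V W : SmoothVB n M}

/-- A family of linear maps between fibres, read in the preferred trivializations at `x₀`. -/
def coordMap (φ : ∀ x, V.Fiber x →ₗ[ℝ] W.Fiber x) (x₀ x : M) : V.Model →L[ℝ] W.Model :=
  LinearMap.toContinuousLinearMap
    ((W.triv x₀).linearMapAt ℝ x ∘ₗ φ x ∘ₗ (V.triv x₀).symmₗ ℝ x)

theorem coordMap_apply (φ : ∀ x, V.Fiber x →ₗ[ℝ] W.Fiber x) {x₀ x : M}
    (hV : x ∈ (V.triv x₀).baseSet) (hW : x ∈ (W.triv x₀).baseSet) (v : V.Model) :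
    coordMap φ x₀ x v = ((W.triv x₀) ⟨x, φ x ((V.triv x₀).symm x v)⟩).2 := by
  simp [coordMap, hV, hW]

/-- A family of linear maps that sends smooth sections to smooth sections is smooth in
coordinates. -/
theorem contMDiffAt_coordMap [T2Space M] [IsManifold (𝓡 n) ∞ M]
    {φ : ∀ x, V.Fiber x →ₗ[ℝ] W.Fiber x}
    (h : ∀ s : V.Sec, ContMDiff (𝓡 n) ((𝓡 n).prod 𝓘(ℝ, W.Model)) ∞
      (fun x => TotalSpace.mk' W.Model x (φ x (s x)))) {x₀ x : M}
    (hV : x ∈ (V.triv x₀).baseSet) (hW : x ∈ (W.triv x₀).baseSet) :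
    ContMDiffAt (𝓡 n) 𝓘(ℝ, V.Model →L[ℝ] W.Model) ∞ (coordMap φ x₀) x := by
  refine contMDiffAt_clm_of_apply fun v => ?_
  obtain ⟨t, ht⟩ := V.exists_sec_eventuallyEq_triv_symm hV v
  refine (((W.triv x₀).contMDiffAt_section_iff hW).1 (h t x)).congr_of_eventuallyEq ?_
  filter_upwards [ht, (V.triv x₀).open_baseSet.mem_nhds hV,
    (W.triv x₀).open_baseSet.mem_nhds hW] with y hy hyV hyW
  rw [coordMap_apply φ hyV hyW, hy]

/-- A family of linear maps that sends smooth sections to smooth sections is a smooth bundle map. -/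
theorem isSmoothBundleMap_of_sec [T2Space M] [IsManifold (𝓡 n) ∞ M]
    {φ : ∀ x, V.Fiber x →ₗ[ℝ] W.Fiber x}
    (h : ∀ s : V.Sec, ContMDiff (𝓡 n) ((𝓡 n).prod 𝓘(ℝ, W.Model)) ∞
      (fun x => TotalSpace.mk' W.Model x (φ x (s x)))) :
    IsSmoothBundleMap n V.Model V.Fiber W.Model W.Fiber φ := by
  intro p₀
  refine contMDiffAt_totalSpace.2 ⟨contMDiffAt_proj V.Fiber, ?_⟩
  have hV := FiberBundle.mem_baseSet_trivializationAt' (F := V.Model) (E := V.Fiber) p₀.1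
  have hW := FiberBundle.mem_baseSet_trivializationAt' (F := W.Model) (E := W.Fiber) p₀.1
  have h1 : ContMDiffAt ((𝓡 n).prod 𝓘(ℝ, V.Model)) 𝓘(ℝ, V.Model →L[ℝ] W.Model) ∞
      (fun p : TotalSpace V.Model V.Fiber => coordMap φ p₀.1 p.1) p₀ :=
    (contMDiffAt_coordMap h hV hW).comp p₀ (contMDiffAt_proj V.Fiber)
  have h2 : ContMDiffAt ((𝓡 n).prod 𝓘(ℝ, V.Model)) 𝓘(ℝ, V.Model) ∞
      (fun p : TotalSpace V.Model V.Fiber => ((V.triv p₀.1) p).2) p₀ :=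
    (contMDiffAt_totalSpace.1 contMDiffAt_id).2
  refine (h1.clm_apply h2).congr_of_eventuallyEq ?_
  have hc := FiberBundle.continuous_proj V.Model V.Fiber
  filter_upwards [hc.continuousAt.preimage_mem_nhds ((V.triv p₀.1).open_baseSet.mem_nhds hV),
    hc.continuousAt.preimage_mem_nhds ((W.triv p₀.1).open_baseSet.mem_nhds hW)] with p hpV hpW
  rw [coordMap_apply φ hpV hpW, (V.triv p₀.1).symm_apply_apply_mk hpV]

theorem contMDiff_apply_sec {φ : ∀ x, V.Fiber x →ₗ[ℝ] W.Fiber x}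
    (h : IsSmoothBundleMap n V.Model V.Fiber W.Model W.Fiber φ) (s : V.Sec) :
    ContMDiff (𝓡 n) ((𝓡 n).prod 𝓘(ℝ, W.Model)) ∞
      (fun x => TotalSpace.mk' W.Model x (φ x (s x))) :=
  ContMDiff.comp h s.contMDiff

end SmoothVB

end

/-! ### Lifting sections along surjective bundle maps -/

section

variable {n : ℕ} {M : Type*} [TopologicalSpace M] [ChartedSpace (EuclideanSpace ℝ (Fin n)) M]

/-- Inversion is smooth at the units of a complete normed algebra; the value 0 of `Ring.inverse` off
the units does no harm because the units are open. -/
theorem contMDiffAt_ringInverse_clm {F : Type*} [NormedAddCommGroup F] [NormedSpace ℝ F]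
    [FiniteDimensional ℝ F] {A : M → F →L[ℝ] F} {x : M}
    (hA : ContMDiffAt (𝓡 n) 𝓘(ℝ, F →L[ℝ] F) ∞ A x) (hx : IsUnit (A x)) :
    ContMDiffAt (𝓡 n) 𝓘(ℝ, F →L[ℝ] F) ∞ (fun y => Ring.inverse (A y)) x := by
  have : CompleteSpace F := FiniteDimensional.complete ℝ F
  obtain ⟨u, hu⟩ := hx
  have h := contDiffAt_ringInverse ℝ (n := ∞) u
  rw [hu] at h
  exact h.contMDiffAt.comp x hA

namespace SmoothVB

variable {V W : SmoothVB n M}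

theorem contMDiffAt_triv_symm (V : SmoothVB n M) {x₀ x : M} (hV : x ∈ (V.triv x₀).baseSet)
    {w : M → V.Model} (hw : ContMDiffAt (𝓡 n) 𝓘(ℝ, V.Model) ∞ w x) :
    ContMDiffAt (𝓡 n) ((𝓡 n).prod 𝓘(ℝ, V.Model)) ∞
      (fun y => TotalSpace.mk' V.Model y ((V.triv x₀).symm y (w y))) x := by
  rw [(V.triv x₀).contMDiffAt_section_iff hV]
  refine hw.congr_of_eventuallyEq ?_
  filter_upwards [(V.triv x₀).open_baseSet.mem_nhds hV] with y hy
  rw [(V.triv x₀).apply_mk_symm hy]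

theorem coordMap_surjective {φ : ∀ x, V.Fiber x →ₗ[ℝ] W.Fiber x} {x₀ x : M}
    (hV : x ∈ (V.triv x₀).baseSet) (hW : x ∈ (W.triv x₀).baseSet)
    (h : Function.Surjective (φ x)) : Function.Surjective (coordMap φ x₀ x) := by
  intro w
  obtain ⟨v, hv⟩ := h ((W.triv x₀).symm x w)
  refine ⟨((V.triv x₀) ⟨x, v⟩).2, ?_⟩
  rw [coordMap_apply φ hV hW, (V.triv x₀).symm_apply_apply_mk hV, hv,
    (W.triv x₀).apply_mk_symm hW]

/-- Smooth sections lift along surjective smooth bundle maps. -/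
theorem exists_lift_of_surjective [T2Space M] [SigmaCompactSpace M] [IsManifold (𝓡 n) ∞ M]
    {φ : ∀ x, V.Fiber x →ₗ[ℝ] W.Fiber x}
    (hφ : IsSmoothBundleMap n V.Model V.Fiber W.Model W.Fiber φ)
    (hs : ∀ x, Function.Surjective (φ x)) (m : W.Sec) :
    ∃ s : V.Sec, ∀ x, φ x (s x) = m x := by
  -- The lifts of `m x` form an affine, hence convex, subset of the fibre, so a partition of unity
  -- glues local smooth lifts.
  refine exists_contMDiffSection_forall_mem_convex_of_local (n := ⊤) (𝓡 n) V.Fiber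
    (fun x => {v | φ x v = m x}) (fun x a ha b hb s t _ _ hst => ?_) fun x₀ => ?_
  · change φ x (s • a + t • b) = m x
    rw [map_add, map_smul, map_smul, show φ x a = m x from ha, show φ x b = m x from hb,
      ← add_smul, hst, one_smul]
  have hV := FiberBundle.mem_baseSet_trivializationAt' (F := V.Model) (E := V.Fiber) x₀
  have hW := FiberBundle.mem_baseSet_trivializationAt' (F := W.Model) (E := W.Fiber) x₀
  -- `C` inverts the coordinate matrix on the right at `x₀` only. The composite `A` is the identity
  -- there, hence invertible nearby, and `C ∘ A⁻¹` is a smooth right inverse near `x₀`.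
  obtain ⟨C, hC⟩ := (coordMap φ x₀ x₀ : V.Model →ₗ[ℝ] W.Model).exists_rightInverse_of_surjective
    (LinearMap.range_eq_top.2 (coordMap_surjective hV hW (hs x₀)))
  let A : M → W.Model →L[ℝ] W.Model := fun x => coordMap φ x₀ x ∘L LinearMap.toContinuousLinearMap C
  have hA0 : A x₀ = 1 := by
    ext v
    exact congrArg (fun g => g v) hC
  have hA : ∀ x ∈ (V.triv x₀).baseSet, x ∈ (W.triv x₀).baseSet →
      ContMDiffAt (𝓡 n) 𝓘(ℝ, W.Model →L[ℝ] W.Model) ∞ A x := fun x hxV hxW =>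
    (contMDiffAt_coordMap (contMDiff_apply_sec hφ) hxV hxW).clm_comp contMDiffAt_const
  have : CompleteSpace W.Model := FiniteDimensional.complete ℝ W.Model
  let U : Set M := {x | x ∈ (V.triv x₀).baseSet ∧ x ∈ (W.triv x₀).baseSet ∧ IsUnit (A x)}
  let w : M → V.Model := fun x => C (Ring.inverse (A x) ((W.triv x₀) ⟨x, m x⟩).2)
  refine ⟨U, ?_, fun x => (V.triv x₀).symm x (w x), fun x hx => ?_, fun x hx => ?_⟩
  · filter_upwards [(V.triv x₀).open_baseSet.mem_nhds hV, (W.triv x₀).open_baseSet.mem_nhds hW,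
      (hA x₀ hV hW).continuousAt.preimage_mem_nhds
        (Units.isOpen.mem_nhds (show IsUnit (A x₀) from hA0 ▸ isUnit_one))] with x h1 h2 h3
    exact ⟨h1, h2, h3⟩
  · obtain ⟨hxV, hxW, hxA⟩ := hx
    have h1 := ((W.triv x₀).contMDiffAt_section_iff hxW).1 (m.contMDiff x)
    have h2 := (contMDiffAt_ringInverse_clm (hA x hxV hxW) hxA).clm_apply h1
    exact (contMDiffAt_triv_symm V hxV
      ((LinearMap.toContinuousLinearMap C).contMDiff.contMDiffAt.comp x h2)).contMDiffWithinAt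
  · obtain ⟨hxV, hxW, hxA⟩ := hx
    have h1 : ((W.triv x₀) ⟨x, φ x ((V.triv x₀).symm x (w x))⟩).2 = ((W.triv x₀) ⟨x, m x⟩).2 := by
      rw [← coordMap_apply φ hxV hxW]
      exact congrArg (fun g : W.Model →L[ℝ] W.Model => g ((W.triv x₀) ⟨x, m x⟩).2)
        (Ring.mul_inverse_cancel _ hxA)
    have h2 := congrArg ((W.triv x₀).symm x) h1
    rwa [(W.triv x₀).symm_apply_apply_mk hxW, (W.triv x₀).symm_apply_apply_mk hxW] at h2

end SmoothVB

end

/-! ### The quotient bundle by the kernel of a map of constant rank -/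

section

variable {n : ℕ} {M : Type*} [TopologicalSpace M] [ChartedSpace (EuclideanSpace ℝ (Fin n)) M]

namespace SmoothVB

/-- The topology of a fibre is not assumed compatible with its linear structure; compatibility is
transported from the model. This and the next lemmas make linear maps out of fibres continuous. -/
theorem isTopologicalAddGroup_fiber (V : SmoothVB n M) (x : M) :
    IsTopologicalAddGroup (V.Fiber x) :=
  (VectorBundle.continuousLinearEquivAt ℝ V.Model V.Fiber x).toContinuousAddEquiv.isTopologicalAddGroup

theorem continuousSMul_fiber (V : SmoothVB n M) (x : M) : ContinuousSMul ℝ (V.Fiber x) := by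
  let e := VectorBundle.continuousLinearEquivAt ℝ V.Model V.Fiber x
  refine ⟨?_⟩
  have : (fun p : ℝ × V.Fiber x => p.1 • p.2) = fun p => e.symm (p.1 • e p.2) := by
    funext p
    simp
  rw [this]
  exact e.symm.continuous.comp (continuous_fst.smul (e.continuous.comp continuous_snd))

theorem t2Space_fiber (V : SmoothVB n M) (x : M) : T2Space (V.Fiber x) :=
  (VectorBundle.continuousLinearEquivAt ℝ V.Model V.Fiber x).toHomeomorph.symm.t2Space

theorem finiteDimensional_fiber (V : SmoothVB n M) (x : M) : FiniteDimensional ℝ (V.Fiber x) :=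
  VectorBundle.finiteDimensional ℝ V.Model V.Fiber x

/-- A linear isomorphism from a quotient of a fibre to a normed space is a homeomorphism. -/
theorem isInducing_quotient_equiv (V : SmoothVB n M) {x : M} {K : Submodule ℝ (V.Fiber x)}
    {F : Type*} [NormedAddCommGroup F] [NormedSpace ℝ F] [FiniteDimensional ℝ F]
    (g : (V.Fiber x ⧸ K) ≃ₗ[ℝ] F) : IsInducing g := by
  have := V.isTopologicalAddGroup_fiber x
  have := V.continuousSMul_fiber x
  have := V.t2Space_fiber x
  have := V.finiteDimensional_fiber x
  have h1 : Continuous g := by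
    refine isQuotientMap_quot_mk.continuous_iff.2 ?_
    exact LinearMap.continuous_of_finiteDimensional (g.toLinearMap ∘ₗ K.mkQ)
  have h2 : Continuous g.symm := LinearMap.continuous_of_finiteDimensional g.symm.toLinearMap
  exact (Homeomorph.mk g.toEquiv h1 h2).isInducing

variable {V W : SmoothVB n M}

/-- Data at `x₀` that trivializes the quotient by the kernel of a bundle map of constant rank:
linear maps `P` and `C` for which `P A C` is invertible at `x₀`, where `A` is the coordinate matrix
of the bundle map. -/
structure QuotientChart (φ : ∀ x, V.Fiber x →ₗ[ℝ] W.Fiber x) (x₀ : M) (F : Type*)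
    [NormedAddCommGroup F] [NormedSpace ℝ F] where
  P : W.Model →L[ℝ] F
  C : F →L[ℝ] V.Model
  isUnit : IsUnit (P ∘L coordMap φ x₀ x₀ ∘L C)

namespace QuotientChart

variable {φ : ∀ x, V.Fiber x →ₗ[ℝ] W.Fiber x} {x₀ : M} {F : Type*}
    [NormedAddCommGroup F] [NormedSpace ℝ F]

/-- An isomorphism `g` from the range of `φ x₀` to `F` extends to a map `p` on the whole fibre of
`W`, and the composite of `g` with `φ x₀` has a right inverse `c`. Then `p ∘ φ x₀ ∘ c = 1`, and `P`,
`C` are `p`, `c` read in the trivializations. -/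
theorem nonempty [FiniteDimensional ℝ F] (φ : ∀ x, V.Fiber x →ₗ[ℝ] W.Fiber x) (x₀ : M)
    (h : Module.finrank ℝ (LinearMap.range (φ x₀)) = Module.finrank ℝ F) :
    Nonempty (QuotientChart φ x₀ F) := by
  have := V.finiteDimensional_fiber x₀
  have := W.finiteDimensional_fiber x₀
  have hV := FiberBundle.mem_baseSet_trivializationAt' (F := V.Model) (E := V.Fiber) x₀
  have hW := FiberBundle.mem_baseSet_trivializationAt' (F := W.Model) (E := W.Fiber) x₀
  let g : LinearMap.range (φ x₀) ≃ₗ[ℝ] F := LinearEquiv.ofFinrankEq _ _ h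
  obtain ⟨p, hp⟩ := g.toLinearMap.exists_extend
  obtain ⟨c, hc⟩ := (g.toLinearMap ∘ₗ (φ x₀).rangeRestrict).exists_rightInverse_of_surjective
    (LinearMap.range_eq_top.2 (g.surjective.comp (φ x₀).surjective_rangeRestrict))
  let eV := (V.triv x₀).linearEquivAt ℝ x₀ hV
  let eW := (W.triv x₀).linearEquivAt ℝ x₀ hW
  refine ⟨⟨LinearMap.toContinuousLinearMap (p ∘ₗ eW.symm.toLinearMap),
    LinearMap.toContinuousLinearMap (eV.toLinearMap ∘ₗ c), ?_⟩⟩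
  convert isUnit_one
  ext v
  have h1 : eW.symm (coordMap φ x₀ x₀ (eV (c v))) = φ x₀ (c v) := by
    rw [coordMap_apply φ hV hW]
    change (W.triv x₀).symm x₀ _ = _
    rw [(W.triv x₀).symm_apply_apply_mk hW]
    exact congrArg (φ x₀) ((V.triv x₀).symm_apply_apply_mk hV (c v))
  change p (eW.symm (coordMap φ x₀ x₀ (eV (c v)))) = v
  rw [h1]
  have h2 := congrArg (fun f => f ((φ x₀).rangeRestrict (c v))) hp
  have h3 := congrArg (fun f => f v) hc
  exact h2.trans h3

variable (T : QuotientChart φ x₀ F)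

/-- The matrix `P A C`. -/
def mat (x : M) : F →L[ℝ] F := T.P ∘L coordMap φ x₀ x ∘L T.C

/-- The domain of the chart. -/
def dom : Set M :=
  ((V.triv x₀).baseSet ∩ (W.triv x₀).baseSet) ∩ T.mat ⁻¹' {A | IsUnit A}

/-- The map from `V` to the model that has kernel `ker φ` over the domain. -/
def proj (x : M) : V.Fiber x →ₗ[ℝ] F :=
  (Ring.inverse (T.mat x) ∘L T.P).toLinearMap ∘ₗ (W.triv x₀).linearMapAt ℝ x ∘ₗ φ x

/-- A right inverse of `proj` over the domain. -/
def lift (x : M) : F →ₗ[ℝ] V.Fiber x := (V.triv x₀).symmₗ ℝ x ∘ₗ T.C.toLinearMap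

theorem mem_dom_self : x₀ ∈ T.dom :=
  ⟨⟨FiberBundle.mem_baseSet_trivializationAt' x₀, FiberBundle.mem_baseSet_trivializationAt' x₀⟩,
    T.isUnit⟩

/-- In coordinates `proj` is `(P A C)⁻¹ P A` and `lift` is the constant matrix `C`. -/
theorem proj_lift {x : M} (hx : x ∈ T.dom) (v : F) : T.proj x (T.lift x v) = v :=
  congrArg (fun g : F →L[ℝ] F => g v) (Ring.inverse_mul_cancel _ hx.2)

theorem ker_le (x : M) : LinearMap.ker (φ x) ≤ LinearMap.ker (T.proj x) := by
  intro v hv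
  rw [LinearMap.mem_ker] at hv ⊢
  simp [proj, hv]

/-- Here constant rank enters: `proj` is onto `F`, so it has the same rank as `φ x`, and the
inclusion of kernels is an equality by dimension. -/
theorem ker_eq [FiniteDimensional ℝ F]
    (h : ∀ x, Module.finrank ℝ (LinearMap.range (φ x)) = Module.finrank ℝ F)
    {x : M} (hx : x ∈ T.dom) : LinearMap.ker (T.proj x) = LinearMap.ker (φ x) := by
  have := V.finiteDimensional_fiber x
  have hs : LinearMap.range (T.proj x) = ⊤ :=
    LinearMap.range_eq_top.2 fun v => ⟨_, T.proj_lift hx v⟩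
  have h1 := LinearMap.finrank_range_add_finrank_ker (φ x)
  have h2 := LinearMap.finrank_range_add_finrank_ker (T.proj x)
  rw [hs, finrank_top] at h2
  rw [h x] at h1
  exact (Submodule.eq_of_le_of_finrank_eq (T.ker_le x) (by omega)).symm

/-- The map induced by `proj` on the quotient. -/
def quotProj (x : M) : (V.Fiber x ⧸ LinearMap.ker (φ x)) →ₗ[ℝ] F :=
  (LinearMap.ker (φ x)).liftQ (T.proj x) (T.ker_le x)

/-- The inverse of `quotProj` over the domain. -/
def quotLift (x : M) : F →ₗ[ℝ] V.Fiber x ⧸ LinearMap.ker (φ x) :=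
  (LinearMap.ker (φ x)).mkQ ∘ₗ T.lift x

theorem quotProj_quotLift {x : M} (hx : x ∈ T.dom) (v : F) : T.quotProj x (T.quotLift x v) = v :=
  T.proj_lift hx v

theorem quotLift_quotProj [FiniteDimensional ℝ F]
    (h : ∀ x, Module.finrank ℝ (LinearMap.range (φ x)) = Module.finrank ℝ F)
    {x : M} (hx : x ∈ T.dom) (q : V.Fiber x ⧸ LinearMap.ker (φ x)) :
    T.quotLift x (T.quotProj x q) = q := by
  obtain ⟨v, rfl⟩ := Submodule.mkQ_surjective _ q
  refine (Submodule.Quotient.eq _).2 ((T.ker_eq h hx).le ?_)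
  rw [LinearMap.mem_ker, map_sub, sub_eq_zero]
  exact T.proj_lift hx _

variable [T2Space M] [IsManifold (𝓡 n) ∞ M]

theorem contMDiffAt_mat (hφ : IsSmoothBundleMap n V.Model V.Fiber W.Model W.Fiber φ) {x : M}
    (hV : x ∈ (V.triv x₀).baseSet) (hW : x ∈ (W.triv x₀).baseSet) :
    ContMDiffAt (𝓡 n) 𝓘(ℝ, F →L[ℝ] F) ∞ T.mat x :=
  contMDiffAt_const.clm_comp
    ((contMDiffAt_coordMap (contMDiff_apply_sec hφ) hV hW).clm_comp contMDiffAt_const)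

theorem isOpen_dom [FiniteDimensional ℝ F]
    (hφ : IsSmoothBundleMap n V.Model V.Fiber W.Model W.Fiber φ) : IsOpen T.dom := by
  have : CompleteSpace F := FiniteDimensional.complete ℝ F
  exact ContinuousOn.isOpen_inter_preimage
    (fun x hx => (T.contMDiffAt_mat hφ hx.1 hx.2).continuousAt.continuousWithinAt)
    ((V.triv x₀).open_baseSet.inter (W.triv x₀).open_baseSet) Units.isOpen

/-- The induced pretrivialization of the quotient. -/
def pretriv [FiniteDimensional ℝ F] (hφ : IsSmoothBundleMap n V.Model V.Fiber W.Model W.Fiber φ)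
    (h : ∀ x, Module.finrank ℝ (LinearMap.range (φ x)) = Module.finrank ℝ F) :
    Pretrivialization F (π F fun x => V.Fiber x ⧸ LinearMap.ker (φ x)) where
  toFun p := (p.1, T.quotProj p.1 p.2)
  invFun p := ⟨p.1, T.quotLift p.1 p.2⟩
  source := π F (fun x => V.Fiber x ⧸ LinearMap.ker (φ x)) ⁻¹' T.dom
  target := T.dom ×ˢ Set.univ
  map_source' _ hp := ⟨hp, trivial⟩
  map_target' _ hp := hp.1
  left_inv' p hp := congrArg (TotalSpace.mk p.1) (T.quotLift_quotProj h hp p.2)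
  right_inv' p hp := Prod.ext rfl (T.quotProj_quotLift hp.1 p.2)
  open_target := (T.isOpen_dom hφ).prod isOpen_univ
  baseSet := T.dom
  open_baseSet := T.isOpen_dom hφ
  source_eq := rfl
  target_eq := rfl
  proj_toFun _ _ := rfl

end QuotientChart

variable [T2Space M] [IsManifold (𝓡 n) ∞ M]
  {φ : ∀ x, V.Fiber x →ₗ[ℝ] W.Fiber x} {F : Type*}
  [NormedAddCommGroup F] [NormedSpace ℝ F] [FiniteDimensional ℝ F]

/-- The transition map is `T₁.proj ∘ T₀.lift`, which no longer involves the quotient: it applies the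
smooth map `φ` to a smooth local section of `V`, then `P` and a smooth inverse matrix. -/
theorem exists_smooth_quotient_coordChange
    (hφ : IsSmoothBundleMap n V.Model V.Fiber W.Model W.Fiber φ)
    (h : ∀ x, Module.finrank ℝ (LinearMap.range (φ x)) = Module.finrank ℝ F)
    {x₀ x₁ : M} (T₀ : QuotientChart φ x₀ F) (T₁ : QuotientChart φ x₁ F) :
    ∃ f : M → F →L[ℝ] F,
      ContMDiffOn (𝓡 n) 𝓘(ℝ, F →L[ℝ] F) ∞ f
        ((T₀.pretriv hφ h).baseSet ∩ (T₁.pretriv hφ h).baseSet) ∧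
      ∀ b ∈ (T₀.pretriv hφ h).baseSet ∩ (T₁.pretriv hφ h).baseSet, ∀ v : F,
        f b v = (T₁.pretriv hφ h ⟨b, (T₀.pretriv hφ h).symm b v⟩).2 := by
  refine ⟨fun x => LinearMap.toContinuousLinearMap (T₁.proj x ∘ₗ T₀.lift x), fun x hx => ?_,
    fun x hx v => ?_⟩
  · refine (contMDiffAt_clm_of_apply fun v => ?_).contMDiffWithinAt
    have hx0 : x ∈ T₀.dom := hx.1
    have hx1 : x ∈ T₁.dom := hx.2
    have hV0 : x ∈ (V.triv x₀).baseSet := hx0.1.1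
    have hW1 : x ∈ (W.triv x₁).baseSet := hx1.1.2
    obtain ⟨t, ht⟩ := V.exists_sec_eventuallyEq_triv_symm hV0 (T₀.C v)
    have h1 := ((W.triv x₁).contMDiffAt_section_iff hW1).1 (contMDiff_apply_sec hφ t x)
    have h2 := (contMDiffAt_ringInverse_clm (T₁.contMDiffAt_mat hφ hx1.1.1 hx1.1.2)
      hx1.2).clm_apply (T₁.P.contMDiff.contMDiffAt.comp x h1)
    refine h2.congr_of_eventuallyEq ?_
    filter_upwards [ht, (V.triv x₀).open_baseSet.mem_nhds hV0,
      (W.triv x₁).open_baseSet.mem_nhds hW1] with y hy hyV hyW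
    simp [QuotientChart.proj, QuotientChart.lift, hy, hyV, hyW]
  · rw [(T₀.pretriv hφ h).mk_symm hx.1]
    rfl

variable (hφ : IsSmoothBundleMap n V.Model V.Fiber W.Model W.Fiber φ)
  (h : ∀ x, Module.finrank ℝ (LinearMap.range (φ x)) = Module.finrank ℝ F)
  (T : ∀ x, QuotientChart φ x F)

/-- The quotient by the kernel of a bundle map of constant rank, as a prebundle. -/
def quotientPrebundle :
    VectorPrebundle ℝ F (fun x => V.Fiber x ⧸ LinearMap.ker (φ x)) where
  pretrivializationAtlas := Set.range fun x => (T x).pretriv hφ h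
  pretrivialization_linear' := by
    rintro _ ⟨x₀, rfl⟩
    exact ⟨fun x hx => ((T x₀).quotProj x).isLinear⟩
  pretrivializationAt x := (T x).pretriv hφ h
  mem_base_pretrivializationAt x := (T x).mem_dom_self
  pretrivialization_mem_atlas x := ⟨x, rfl⟩
  exists_coordChange := by
    rintro _ ⟨x₀, rfl⟩ _ ⟨x₁, rfl⟩
    obtain ⟨f, hf, hf'⟩ := exists_smooth_quotient_coordChange hφ h (T x₀) (T x₁)
    exact ⟨f, hf.continuousOn, hf'⟩
  -- The bundle topology has to restrict to the quotient topology on each fibre. This holds because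
  -- the chart centred at `x` is a linear bijection from that fibre to `F`.
  totalSpaceMk_isInducing x := by
    have hb : Function.Bijective ((T x).quotProj x) :=
      ⟨Function.LeftInverse.injective ((T x).quotLift_quotProj h (T x).mem_dom_self),
        Function.RightInverse.surjective ((T x).quotProj_quotLift (T x).mem_dom_self)⟩
    exact (isInducing_prodMkRight x).comp
      (V.isInducing_quotient_equiv (LinearEquiv.ofBijective _ hb))

theorem quotientPrebundle_isContMDiff : (quotientPrebundle hφ h T).IsContMDiff (𝓡 n) ∞ where
  exists_contMDiffCoordChange := by
    rintro _ ⟨x₀, rfl⟩ _ ⟨x₁, rfl⟩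
    exact exists_smooth_quotient_coordChange hφ h (T x₀) (T x₁)

/-- The kernel of a bundle map of constant rank has a smooth quotient bundle. -/
theorem nonempty_quotientBundle {F : Type w} [NormedAddCommGroup F] [NormedSpace ℝ F]
    [FiniteDimensional ℝ F]
    (hφ : IsSmoothBundleMap n V.Model V.Fiber W.Model W.Fiber φ)
    (h : ∀ x, Module.finrank ℝ (LinearMap.range (φ x)) = Module.finrank ℝ F) :
    Nonempty (QuotientBundle.{_, w, _, _} V (fun x => LinearMap.ker (φ x))) := by
  let T : ∀ x, QuotientChart φ x F := fun x => (QuotientChart.nonempty φ x (h x)).some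
  let a := quotientPrebundle hφ h T
  let _ := a.totalSpaceTopology
  let _ := a.toFiberBundle
  let _ := a.toVectorBundle
  have := quotientPrebundle_isContMDiff hφ h T
  let _ := a.contMDiffVectorBundle (n := ∞) (IB := 𝓡 n)
  refine ⟨{ Model := F, smooth_proj := ?_ }⟩
  intro p₀
  refine contMDiffAt_totalSpace.2 ⟨contMDiffAt_proj V.Fiber, ?_⟩
  obtain ⟨⟨hV, hW⟩, hu⟩ := (T p₀.1).mem_dom_self
  have hc := FiberBundle.continuous_proj V.Model V.Fiber
  have h1 := (contMDiffAt_totalSpace.1 (hφ p₀)).2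
  have h2 : ContMDiffAt ((𝓡 n).prod 𝓘(ℝ, V.Model)) 𝓘(ℝ, F →L[ℝ] F) ∞
      (fun p : TotalSpace V.Model V.Fiber => Ring.inverse ((T p₀.1).mat p.1)) p₀ :=
    (contMDiffAt_ringInverse_clm ((T p₀.1).contMDiffAt_mat hφ hV hW) hu).comp p₀
      (contMDiffAt_proj V.Fiber)
  refine (h2.clm_apply ((T p₀.1).P.contMDiff.contMDiffAt.comp p₀ h1)).congr_of_eventuallyEq ?_
  filter_upwards [hc.continuousAt.preimage_mem_nhds ((W.triv p₀.1).open_baseSet.mem_nhds hW)]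
    with p hp
  -- In the chart centred at the base point of `p₀`, the quotient projection is read as `proj`.
  change (T p₀.1).proj p.1 p.2 = _
  have hp' : p.1 ∈ (W.triv p₀.1).baseSet := hp
  simp [QuotientChart.proj, hp']

end SmoothVB

end

/-! ### The pairing, ρ*, and consequences of exactness -/

section

variable {n : ℕ} {M : Type*} [TopologicalSpace M] [ChartedSpace (EuclideanSpace ℝ (Fin n)) M]

theorem differential_mul {f g : M → ℝ} (hf : ContMDiff (𝓡 n) 𝓘(ℝ, ℝ) ∞ f)
    (hg : ContMDiff (𝓡 n) 𝓘(ℝ, ℝ) ∞ g) (x : M) (v : TangentSpace (𝓡 n) x) :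
    differential n (fun p => f p * g p) x v
      = f x * differential n g x v + differential n f x v * g x := by
  have h1 := (hf.mdifferentiable (by simp) x).hasMFDerivAt
  have h2 := (hg.mdifferentiable (by simp) x).hasMFDerivAt
  have h3 := (h1.mul h2).mfderiv
  have h4 := congrArg (fun L : TangentSpace (𝓡 n) x →L[ℝ] ℝ => L v) h3
  refine h4.trans ?_
  change f x * differential n g x v + g x * differential n f x v = _
  ring

theorem differential_eq_zero {f : M → ℝ} (hf : ∀ x, f x = 0) (x : M) (v : TangentSpace (𝓡 n) x) :
    differential n f x v = 0 := by
  obtain rfl : f = fun _ => 0 := funext hf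
  exact congrArg (fun L : TangentSpace (𝓡 n) x →L[ℝ] ℝ => L v) mfderiv_const

theorem exists_cotangent_eq {x : M} (β : TangentSpace (𝓡 n) x →ₗ[ℝ] ℝ) :
    ∃ α : CotSpace n x, ∀ v, α v = β v := by
  have : FiniteDimensional ℝ (TangentSpace (𝓡 n) x) :=
    inferInstanceAs (FiniteDimensional ℝ (EuclideanSpace ℝ (Fin n)))
  have : T2Space (TangentSpace (𝓡 n) x) := inferInstanceAs (T2Space (EuclideanSpace ℝ (Fin n)))
  exact ⟨LinearMap.toContinuousLinearMap β, fun v => rfl⟩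

/-- The cotangent bundle. -/
abbrev cotangentVB (n : ℕ) (M : Type*) [TopologicalSpace M]
    [ChartedSpace (EuclideanSpace ℝ (Fin n)) M] [IsManifold (𝓡 n) ∞ M] : SmoothVB n M where
  Model := EuclideanSpace ℝ (Fin n) →L[ℝ] ℝ
  Fiber := fun x : M => CotSpace n x

/-- The tangent bundle. -/
abbrev tangentVB (n : ℕ) (M : Type*) [TopologicalSpace M]
    [ChartedSpace (EuclideanSpace ℝ (Fin n)) M] [IsManifold (𝓡 n) ∞ M] : SmoothVB n M where
  Model := EuclideanSpace ℝ (Fin n)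
  Fiber := fun x : M => TangentSpace (𝓡 n) x

theorem contMDiff_cotangent_apply [IsManifold (𝓡 n) ∞ M] (α : (cotangentVB n M).Sec)
    {X : ∀ x : M, TangentSpace (𝓡 n) x}
    (hX : ContMDiff (𝓡 n) ((𝓡 n).prod 𝓘(ℝ, EuclideanSpace ℝ (Fin n))) ∞
      (fun x => TotalSpace.mk' (EuclideanSpace ℝ (Fin n)) x (X x))) :
    ContMDiff (𝓡 n) 𝓘(ℝ, ℝ) ∞ (fun x => (α x : CotSpace n x) (X x)) := by
  have h := ContMDiff.clm_bundle_apply (F₁ := EuclideanSpace ℝ (Fin n)) (F₂ := ℝ)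
    (E₁ := fun x : M => TangentSpace (𝓡 n) x) (E₂ := Bundle.Trivial M ℝ) (b := fun x : M => x)
    (ϕ := fun x => (α x : CotSpace n x)) (v := X) (IM := 𝓡 n) (n := ∞) α.contMDiff hX
  intro x
  exact (contMDiffAt_section x).1 (h x)

namespace SmoothVB

variable {V W : SmoothVB n M}

/-- Along a smooth perfect pairing, a section is smooth if its pairings with smooth sections are. -/
theorem contMDiff_of_pairing [T2Space M] [IsManifold (𝓡 n) ∞ M]
    {S : ∀ x, V.Fiber x →ₗ[ℝ] W.Fiber x →ₗ[ℝ] ℝ} (hp : ∀ x, (S x).IsPerfPair)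
    (hS : ∀ (a : V.Sec) (e : W.Sec), ContMDiff (𝓡 n) 𝓘(ℝ, ℝ) ∞ (fun x => S x (a x) (e x)))
    {a : ∀ x, V.Fiber x}
    (ha : ∀ e : W.Sec, ContMDiff (𝓡 n) 𝓘(ℝ, ℝ) ∞ (fun x => S x (a x) (e x))) :
    ContMDiff (𝓡 n) ((𝓡 n).prod 𝓘(ℝ, V.Model)) ∞ (fun x => TotalSpace.mk' V.Model x (a x)) := by
  intro x₀
  have hV := FiberBundle.mem_baseSet_trivializationAt' (F := V.Model) (E := V.Fiber) x₀
  have hW := FiberBundle.mem_baseSet_trivializationAt' (F := W.Model) (E := W.Fiber) x₀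
  rw [contMDiffAt_section]
  -- In coordinates `g` is the functional `S(a, ·)` and `A` is the pairing as an operator into the
  -- dual of `W.Model`. Both are smooth and `A` is invertible, so `a = A⁻¹ g` is smooth.
  let g : M → W.Model →L[ℝ] ℝ := fun x =>
    LinearMap.toContinuousLinearMap (S x (a x) ∘ₗ (W.triv x₀).symmₗ ℝ x)
  let A : M → V.Model →L[ℝ] W.Model →L[ℝ] ℝ := fun x =>
    LinearMap.toContinuousLinearMap (LinearMap.toContinuousLinearMap.toLinearMap ∘ₗ
      ((S x).compl₁₂ ((V.triv x₀).symmₗ ℝ x) ((W.triv x₀).symmₗ ℝ x)))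
  have hg : ContMDiffAt (𝓡 n) 𝓘(ℝ, W.Model →L[ℝ] ℝ) ∞ g x₀ := by
    refine contMDiffAt_clm_of_apply fun w => ?_
    obtain ⟨t, ht⟩ := W.exists_sec_eventuallyEq_triv_symm hW w
    refine (ha t x₀).congr_of_eventuallyEq ?_
    filter_upwards [ht, (W.triv x₀).open_baseSet.mem_nhds hW] with y hy hyW
    simp [g, hyW, hy]
  have hA : ContMDiffAt (𝓡 n) 𝓘(ℝ, V.Model →L[ℝ] W.Model →L[ℝ] ℝ) ∞ A x₀ := by
    refine contMDiffAt_clm_of_apply fun v => contMDiffAt_clm_of_apply fun w => ?_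
    obtain ⟨s, hs⟩ := V.exists_sec_eventuallyEq_triv_symm hV v
    obtain ⟨t, ht⟩ := W.exists_sec_eventuallyEq_triv_symm hW w
    refine (hS s t x₀).congr_of_eventuallyEq ?_
    filter_upwards [hs, ht, (V.triv x₀).open_baseSet.mem_nhds hV,
      (W.triv x₀).open_baseSet.mem_nhds hW] with y hy hy' hyV hyW
    simp [A, hyV, hyW, hy, hy']
  have hinv : ∀ x ∈ (V.triv x₀).baseSet, x ∈ (W.triv x₀).baseSet →
      ∃ e : V.Model ≃L[ℝ] W.Model →L[ℝ] ℝ, A x = e := fun x hxV hxW => by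
    have := hp x
    let e := ((V.triv x₀).linearEquivAt ℝ x hxV).symm ≪≫ₗ (S x).toPerfPair ≪≫ₗ
      ((W.triv x₀).linearEquivAt ℝ x hxW).symm.dualMap ≪≫ₗ LinearMap.toContinuousLinearMap
    refine ⟨e.toContinuousLinearEquiv, ?_⟩
    ext v w
    simp [A, e, hxV, hxW]
  obtain ⟨e₀, he₀⟩ := hinv x₀ hV hW
  have : CompleteSpace V.Model := FiniteDimensional.complete ℝ V.Model
  have h1 : ContDiffAt ℝ ∞ ContinuousLinearMap.inverse (A x₀) := by
    rw [he₀]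
    exact contDiffAt_map_inverse e₀
  refine ((h1.contMDiffAt.comp x₀ hA).clm_apply hg).congr_of_eventuallyEq ?_
  filter_upwards [(V.triv x₀).open_baseSet.mem_nhds hV,
    (W.triv x₀).open_baseSet.mem_nhds hW] with x hxV hxW
  obtain ⟨e, he⟩ := hinv x hxV hxW
  have h2 : g x = A x ((V.triv x₀) ⟨x, a x⟩).2 := by
    ext w
    simp [g, A, hxV, hxW, (V.triv x₀).symm_apply_apply_mk]
  change _ = ContinuousLinearMap.inverse (A x) (g x)
  rw [h2, he, ContinuousLinearMap.inverse_equiv]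
  exact (e.symm_apply_apply _).symm

end SmoothVB

namespace CLWX

variable [IsManifold (𝓡 n) ∞ M] {E1 E0 : SmoothVB n M} (𝓔 : CLWX E1 E0)

/-- ρ* is built fibrewise from the inverse of the pairing, so its smoothness is read off from S(ρ*α,
e) = α(ρ e). -/
theorem contMDiff_rhoStar [T2Space M] (α : (cotangentVB n M).Sec) :
    ContMDiff (𝓡 n) ((𝓡 n).prod 𝓘(ℝ, E1.Model)) ∞
      (fun x => TotalSpace.mk' E1.Model x (𝓔.rhoStar x (α x))) := by
  refine SmoothVB.contMDiff_of_pairing 𝓔.S_isPerfPair 𝓔.S_smooth fun e => ?_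
  simp_rw [S_rhoStar]
  exact contMDiff_cotangent_apply α
    (SmoothVB.contMDiff_apply_sec (W := tangentVB n M) 𝓔.rho_smooth e)

theorem rhoStar_smooth [T2Space M] : IsSmoothBundleMap n (EuclideanSpace ℝ (Fin n) →L[ℝ] ℝ)
    (fun x : M => CotSpace n x) E1.Model E1.Fiber 𝓔.rhoStar :=
  SmoothVB.isSmoothBundleMap_of_sec (V := cotangentVB n M) 𝓔.contMDiff_rhoStar

theorem eq_of_S {x : M} {a b : E1.Fiber x} (h : ∀ y : E0.Sec, 𝓔.S x a (y x) = 𝓔.S x b (y x))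
    [T2Space M] : a = b := by
  rw [← sub_eq_zero]
  refine (𝓔.S_nondegenerate x).1 _ fun y => ?_
  obtain ⟨y, rfl⟩ := E0.exists_sec_apply_eq x y
  rw [map_sub, LinearMap.sub_apply, h, sub_self]

theorem eq_of_S' {x : M} {y z : E0.Fiber x} (h : ∀ a : E1.Sec, 𝓔.S x (a x) y = 𝓔.S x (a x) z)
    [T2Space M] : y = z := by
  rw [← sub_eq_zero]
  refine (𝓔.S_nondegenerate x).2 _ fun a => ?_
  obtain ⟨a, rfl⟩ := E1.exists_sec_apply_eq x a
  rw [map_sub, h, sub_self]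

/-- The Leibniz rule is not an axiom: it comes from comparing axiom (iv) for `f a` with `f` times
axiom (iv) for `a`, by nondegeneracy of `S`. The same argument in the other slot gives `l00_fsmul`.
-/
theorem l01_fsmul [T2Space M] (e : E0.Sec) (a : E1.Sec) (f : C^∞⟮𝓡 n, M; ℝ⟯) (x : M) :
    𝓔.leib.l01 e (E1.fsmul f a) x
      = f x • 𝓔.leib.l01 e a x + differential n f x (𝓔.rho x (e x)) • a x := by
  refine 𝓔.eq_of_S fun y => ?_
  have h1 := 𝓔.invariant0 e y a x
  have h2 := 𝓔.invariant0 e y (E1.fsmul f a) x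
  have h3 : (fun p => 𝓔.S p (E1.fsmul f a p) (y p)) = fun p => f p * 𝓔.S p (a p) (y p) := by
    funext p
    change 𝓔.S p (f p • a p) (y p) = _
    simp
  have h4 : 𝓔.S x (E1.fsmul f a x) (𝓔.leib.l00 e y x) = f x * 𝓔.S x (a x) (𝓔.leib.l00 e y x) := by
    change 𝓔.S x (f x • a x) _ = _
    simp
  rw [h3, differential_mul f.contMDiff (𝓔.S_smooth a y), h4, h1] at h2
  simp only [map_add, map_smul, LinearMap.add_apply, LinearMap.smul_apply, smul_eq_mul]
  linear_combination -h2

theorem l00_fsmul [T2Space M] (e y : E0.Sec) (f : C^∞⟮𝓡 n, M; ℝ⟯) (x : M) :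
    𝓔.leib.l00 e (E0.fsmul f y) x
      = f x • 𝓔.leib.l00 e y x + differential n f x (𝓔.rho x (e x)) • y x := by
  refine 𝓔.eq_of_S' fun a => ?_
  have h1 := 𝓔.invariant0 e y a x
  have h2 := 𝓔.invariant0 e (E0.fsmul f y) a x
  have h3 : (fun p => 𝓔.S p (a p) (E0.fsmul f y p)) = fun p => f p * 𝓔.S p (a p) (y p) := by
    funext p
    change 𝓔.S p (a p) (f p • y p) = _
    simp
  have h4 : 𝓔.S x (𝓔.leib.l01 e a x) (E0.fsmul f y x) = f x * 𝓔.S x (𝓔.leib.l01 e a x) (y x) := by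
    change 𝓔.S x _ (f x • y x) = _
    simp
  rw [h3, differential_mul f.contMDiff (𝓔.S_smooth a y), h4, h1] at h2
  simp only [map_add, map_smul, smul_eq_mul]
  linear_combination -h2

variable {𝓔}

theorem IsExact.range_rhoStar (h𝓔 : 𝓔.IsExact) (x : M) :
    LinearMap.range (𝓔.rhoStar x) = LinearMap.ker (𝓔.bd x) :=
  (LinearMap.exact_iff.1 (h𝓔.exact_E1 x)).symm

/-- An element of `E_{-1}` that pairs to zero with `ker ρ` lies in the image of `ρ*`. -/
theorem IsExact.mem_range_rhoStar (h𝓔 : 𝓔.IsExact) {x : M} {a : E1.Fiber x}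
    (ha : ∀ u ∈ LinearMap.ker (𝓔.rho x), 𝓔.S x a u = 0) : a ∈ LinearMap.range (𝓔.rhoStar x) := by
  -- With τ a right inverse of ρ, the covector is α = S(a, τ ·). For every `e` the difference e −
  -- τ(ρ e) lies in ker ρ, where S(a, ·) vanishes, so S(a, e) = α(ρ e).
  obtain ⟨τ, hτ⟩ := (𝓔.rho x).exists_rightInverse_of_surjective
    (LinearMap.range_eq_top.2 (h𝓔.surjective x))
  obtain ⟨α, hα⟩ := exists_cotangent_eq (𝓔.S x a ∘ₗ τ)
  refine ⟨α, ?_⟩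
  rw [← sub_eq_zero]
  refine (𝓔.S_nondegenerate x).1 _ fun e => ?_
  rw [map_sub, LinearMap.sub_apply, S_rhoStar, hα, LinearMap.comp_apply, ← map_sub]
  refine ha _ ?_
  rw [LinearMap.mem_ker, map_sub, sub_eq_zero]
  exact congrArg (fun g => g (𝓔.rho x e)) hτ

/-- ker ∂ = im ρ* annihilates ker ρ; this is what makes 𝒮 independent of the lift. -/
theorem S_eq_zero_of_bd (h𝓔 : 𝓔.IsExact) {x : M} {a : E1.Fiber x} (ha : 𝓔.bd x a = 0)
    {u : E0.Fiber x} (hu : 𝓔.rho x u = 0) : 𝓔.S x a u = 0 := by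
  obtain ⟨α, rfl⟩ := (h𝓔.exact_E1 x a).1 ha
  rw [S_rhoStar, hu, map_zero]

theorem d_eq_zero_iff {a : E1.Sec} : 𝓔.leib.d a = 0 ↔ ∀ x, 𝓔.bd x (a x) = 0 := by
  refine ⟨fun h x => ?_, fun h => ContMDiffSection.ext fun x => ?_⟩
  · rw [← 𝓔.leib_d, h]
    rfl
  · rw [𝓔.leib_d, h]
    rfl

/-- Sections of `ker ρ` form an ideal. -/
theorem IsExact.rho_l00 [T2Space M] (h𝓔 : 𝓔.IsExact) (e u : E0.Sec)
    (hu : ∀ x, 𝓔.rho x (u x) = 0) (x : M) : 𝓔.rho x (𝓔.leib.l00 e u x) = 0 := by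
  -- Every covector kills ρ(e ⋄ u): extend it to a 1-form and let `a` be its image under ρ*. Both
  -- `a` and e ⋄ a lie in ker ∂, so S(a, u) and S(e ⋄ a, u) vanish identically, and invariance
  -- leaves S(a, e ⋄ u) = 0, which is the covector evaluated on ρ(e ⋄ u).
  refine (Module.forall_dual_apply_eq_zero_iff ℝ _).1 fun β => ?_
  obtain ⟨α, hα⟩ := exists_cotangent_eq β
  obtain ⟨s, hs⟩ := (cotangentVB n M).exists_sec_apply_eq x α
  let a : E1.Sec := ⟨fun y => 𝓔.rhoStar y (s y), 𝓔.contMDiff_rhoStar s⟩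
  have ha : 𝓔.leib.d a = 0 := d_eq_zero_iff.2 fun y => (h𝓔.exact_E1 y _).2 ⟨s y, rfl⟩
  have ha' : 𝓔.leib.d (𝓔.leib.l01 e a) = 0 := by rw [𝓔.leib.d_l01, ha, map_zero]
  have h := 𝓔.invariant0 e u a x
  rw [differential_eq_zero fun y => S_eq_zero_of_bd h𝓔 (d_eq_zero_iff.1 ha y) (hu y),
    S_eq_zero_of_bd h𝓔 (d_eq_zero_iff.1 ha' x) (hu x)] at h
  have h1 : 𝓔.S x (a x) (𝓔.leib.l00 e u x) = α (𝓔.rho x (𝓔.leib.l00 e u x)) := by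
    rw [← hs]
    exact 𝓔.S_rhoStar x _ _
  rw [h1, zero_add] at h
  rw [← hα, ← h]

/-- The symmetric part of `⋄` takes values in the image of `ρ*`. -/
theorem IsExact.d_l01_add_l10 (h𝓔 : 𝓔.IsExact) (a : E1.Sec) (e : E0.Sec) :
    𝓔.leib.d (𝓔.leib.l01 e a + 𝓔.leib.l10 a e) = 0 := by
  refine d_eq_zero_iff.2 fun x => ?_
  -- Against `u` in ker ρ, axiom (ii) gives the derivative of a function along ρ(u) = 0.
  refine (h𝓔.range_rhoStar x).le (h𝓔.mem_range_rhoStar fun u hu => ?_)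
  rw [𝓔.symm_part, LinearMap.mem_ker.1 hu, map_zero]

end CLWX

end

/-! ### Descent of a Leibniz 2-algebra to the quotient by ker d -/

/-- A right inverse of a surjective linear map. -/
def LinearMap.sectionOfSurjective {V Q : Type*} [AddCommGroup V] [Module ℝ V] [AddCommGroup Q]
    [Module ℝ Q] (p : V →ₗ[ℝ] Q) (hp : Function.Surjective p) : Q →ₗ[ℝ] V :=
  (p.exists_rightInverse_of_surjective (LinearMap.range_eq_top.2 hp)).choose

theorem LinearMap.apply_sectionOfSurjective {V Q : Type*} [AddCommGroup V] [Module ℝ V]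
    [AddCommGroup Q] [Module ℝ Q] (p : V →ₗ[ℝ] Q) (hp : Function.Surjective p) (m : Q) :
    p (p.sectionOfSurjective hp m) = m :=
  congrArg (fun g => g m)
    (p.exists_rightInverse_of_surjective (LinearMap.range_eq_top.2 hp)).choose_spec

namespace Leibniz2Algebra

variable {V1 V0 Q : Type*} [AddCommGroup V1] [Module ℝ V1] [AddCommGroup V0] [Module ℝ V0]
  [AddCommGroup Q] [Module ℝ Q] (L : Leibniz2Algebra V1 V0) (p : V1 →ₗ[ℝ] Q)

variable {p}

theorem d_congr (hker : ∀ a, p a = 0 ↔ L.d a = 0) {a b : V1} (h : p a = p b) : L.d a = L.d b := by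
  rw [← sub_eq_zero, ← map_sub, ← hker, map_sub, h, sub_self]

/-- ker d is stable under the bracket because d(e ⋄ a) = e ⋄ d a. -/
theorem l01_congr (hker : ∀ a, p a = 0 ↔ L.d a = 0) {a b : V1} (h : p a = p b) (e : V0) :
    p (L.l01 e a) = p (L.l01 e b) := by
  rw [← sub_eq_zero, ← map_sub, ← map_sub, hker, L.d_l01, map_sub, L.d_congr hker h, sub_self,
    map_zero]

theorem l10_congr (hker : ∀ a, p a = 0 ↔ L.d a = 0) {a b : V1} (h : p a = p b) (e : V0) :
    p (L.l10 a e) = p (L.l10 b e) := by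
  rw [← sub_eq_zero, ← map_sub, ← LinearMap.sub_apply, ← map_sub, hker, L.d_l10, map_sub,
    L.d_congr hker h, sub_self, map_zero, LinearMap.zero_apply]

variable (p)

/-- The Lie 2-algebra induced by a Leibniz 2-algebra, with skew-symmetric bracket in degree `0` and
skew-symmetric `l₃`, on the quotient of its degree `-1` part by the kernel of `d`. -/
def quotientLie (hp : Function.Surjective p) (hker : ∀ a, p a = 0 ↔ L.d a = 0)
    (h00 : ∀ x y, L.l00 x y = -L.l00 y x) (h01 : ∀ x a, L.d (L.l01 x a + L.l10 a x) = 0)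
    (h3 : ∀ x y z, L.l3 x y z = -L.l3 y x z) (h3' : ∀ x y z, L.l3 x y z = -L.l3 x z y) :
    Lie2Algebra Q V0 :=
  let s := p.sectionOfSurjective hp
  have hs : ∀ m, p (s m) = m := p.apply_sectionOfSurjective hp
  { d := L.d ∘ₗ s
    l00 := L.l00
    l01 := (L.l01.compl₂ s).compr₂ p
    l10 := (L.l10 ∘ₗ s).compr₂ p
    l3 := L.l3.compr₂ (p.compRight ℝ)
    d_l01 := fun x m => by
      change L.d (s (p _)) = _
      rw [L.d_congr hker (hs _)]
      exact L.d_l01 _ _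
    d_l10 := fun m x => by
      change L.d (s (p _)) = _
      rw [L.d_congr hker (hs _)]
      exact L.d_l10 _ _
    l01_d := fun x m => congrArg p (L.l01_d _ _)
    d_l3 := fun x y z => by
      change L.d (s (p _)) = _
      rw [L.d_congr hker (hs _)]
      exact L.d_l3 _ _ _
    l3_d₃ := fun x y m => by
      change p (L.l3 x y (L.d (s m))) = p (L.l01 x (s (p (L.l01 y (s m)))))
        - p (L.l01 (L.l00 x y) (s m)) - p (L.l01 y (s (p (L.l01 x (s m)))))
      -- Each inner `s (p _)` is another lift of the same class and may be replaced by the original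
      -- element; the identity is then the image under `p` of the one in `L`.
      rw [L.l01_congr hker (hs _), L.l01_congr hker (hs _), L.l3_d₃, map_sub, map_sub]
    l3_d₂ := fun x m y => by
      change p (L.l3 x (L.d (s m)) y) = p (L.l01 x (s (p (L.l10 (s m) y))))
        - p (L.l10 (s (p (L.l01 x (s m)))) y) - p (L.l10 (s m) (L.l00 x y))
      rw [L.l01_congr hker (hs _), L.l10_congr hker (hs _), L.l3_d₂, map_sub, map_sub]
    l3_d₁ := fun m x y => by
      change p (L.l3 (L.d (s m)) x y) = p (L.l10 (s m) (L.l00 x y))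
        - p (L.l10 (s (p (L.l10 (s m) x))) y) - p (L.l01 x (s (p (L.l10 (s m) y))))
      rw [L.l01_congr hker (hs _), L.l10_congr hker (hs _), L.l3_d₁, map_sub, map_sub]
    jacobiator := fun w x y z => by
      change p (L.l01 w (s (p (L.l3 x y z)))) - p (L.l01 x (s (p (L.l3 w y z))))
        + p (L.l01 y (s (p (L.l3 w x z)))) + p (L.l10 (s (p (L.l3 w x y))) z)
        - p (L.l3 (L.l00 w x) y z) - p (L.l3 x (L.l00 w y) z) - p (L.l3 x y (L.l00 w z))
        + p (L.l3 w (L.l00 x y) z) + p (L.l3 w y (L.l00 x z)) - p (L.l3 w x (L.l00 y z)) = 0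
      rw [L.l01_congr hker (hs _), L.l01_congr hker (hs _), L.l01_congr hker (hs _),
        L.l10_congr hker (hs _)]
      simp only [← map_sub, ← map_add]
      rw [L.jacobiator, map_zero]
    skew00 := h00
    skew01 := fun x m => by
      change p (L.l01 x (s m)) = -p (L.l10 (s m) x)
      rw [eq_neg_iff_add_eq_zero, ← map_add, hker]
      exact h01 _ _
    skew3_left := fun x y z => by
      change p (L.l3 x y z) = -p (L.l3 y x z)
      rw [h3, map_neg]
    skew3_right := fun x y z => by
      change p (L.l3 x y z) = -p (L.l3 x z y)
      rw [h3', map_neg] }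

section

variable (hp : Function.Surjective p) (hker : ∀ a, p a = 0 ↔ L.d a = 0)
    (h00 : ∀ x y, L.l00 x y = -L.l00 y x) (h01 : ∀ x a, L.d (L.l01 x a + L.l10 a x) = 0)
    (h3 : ∀ x y z, L.l3 x y z = -L.l3 y x z) (h3' : ∀ x y z, L.l3 x y z = -L.l3 x z y)

/-- The structure is defined through one chosen section of `p`; this and the next two lemmas
evaluate it on an arbitrary lift. -/
theorem quotientLie_d (a : V1) : (L.quotientLie p hp hker h00 h01 h3 h3').d (p a) = L.d a :=
  L.d_congr hker (p.apply_sectionOfSurjective hp _)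

theorem quotientLie_l01 (e : V0) (a : V1) :
    (L.quotientLie p hp hker h00 h01 h3 h3').l01 e (p a) = p (L.l01 e a) :=
  L.l01_congr hker (p.apply_sectionOfSurjective hp _) e

theorem quotientLie_l10 (a : V1) (e : V0) :
    (L.quotientLie p hp hker h00 h01 h3 h3').l10 (p a) e = p (L.l10 a e) :=
  L.l10_congr hker (p.apply_sectionOfSurjective hp _) e

end

end Leibniz2Algebra

/-! ### The quadratic Lie 2-algebroid on the quotient -/

namespace CLWX

variable {n : ℕ} {M : Type*} [TopologicalSpace M]
  [ChartedSpace (EuclideanSpace ℝ (Fin n)) M]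
  [IsManifold (𝓡 n) ∞ M] {E1 E0 F1 : SmoothVB n M}

section

variable {𝓔 : CLWX E1 E0}

theorem l3_skew_left (x y z : E0.Sec) : 𝓔.leib.l3 x y z = -𝓔.leib.l3 y x z := by
  refine ContMDiffSection.ext fun p => ?_
  rw [ContMDiffSection.coe_neg, Pi.neg_apply, 𝓔.leib_l3, 𝓔.leib_l3,
    ← (𝓔.Om p).map_swap _ (show (0 : Fin 3) ≠ 1 by decide)]
  congr 1
  funext i
  fin_cases i <;> rfl

theorem l3_skew_right (x y z : E0.Sec) : 𝓔.leib.l3 x y z = -𝓔.leib.l3 x z y := by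
  refine ContMDiffSection.ext fun p => ?_
  rw [ContMDiffSection.coe_neg, Pi.neg_apply, 𝓔.leib_l3, 𝓔.leib_l3,
    ← (𝓔.Om p).map_swap _ (show (1 : Fin 3) ≠ 2 by decide)]
  congr 1
  funext i
  fin_cases i <;> rfl

end

/-- A smooth model of the projection `E_{-1} → E_{-1} / ker ∂`. -/
structure QuotientMap (𝓔 : CLWX E1 E0) (F1 : SmoothVB n M) where
  pr : ∀ x, E1.Fiber x →ₗ[ℝ] F1.Fiber x
  smooth : IsSmoothBundleMap n E1.Model E1.Fiber F1.Model F1.Fiber pr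
  surjective : ∀ x, Function.Surjective (pr x)
  ker_eq : ∀ x, LinearMap.ker (pr x) = LinearMap.ker (𝓔.bd x)

namespace QuotientMap

variable {𝓔 : CLWX E1 E0} (q : QuotientMap 𝓔 F1)

/-- The projection on sections. -/
def secMap : E1.Sec →ₗ[ℝ] F1.Sec where
  toFun a := ⟨fun x => q.pr x (a x), SmoothVB.contMDiff_apply_sec q.smooth a⟩
  map_add' a b := ContMDiffSection.ext fun x => map_add (q.pr x) (a x) (b x)
  map_smul' c a := ContMDiffSection.ext fun x => map_smul (q.pr x) c (a x)

theorem secMap_apply (a : E1.Sec) (x : M) : q.secMap a x = q.pr x (a x) := rfl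

theorem eq_secMap {m : F1.Sec} {a : E1.Sec} (h : ∀ x, q.pr x (a x) = m x) : m = q.secMap a :=
  ContMDiffSection.ext fun x => (h x).symm

theorem pr_eq_zero_iff {x : M} {a : E1.Fiber x} : q.pr x a = 0 ↔ 𝓔.bd x a = 0 := by
  rw [← LinearMap.mem_ker, q.ker_eq, LinearMap.mem_ker]

theorem secMap_eq_zero_iff (a : E1.Sec) : q.secMap a = 0 ↔ 𝓔.leib.d a = 0 := by
  rw [d_eq_zero_iff]
  refine ⟨fun h x => q.pr_eq_zero_iff.1 ?_, fun h => ContMDiffSection.ext fun x =>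
    q.pr_eq_zero_iff.2 (h x)⟩
  rw [← q.secMap_apply, h]
  rfl

/-- The map induced by `∂` on the quotient. -/
def l1 (x : M) : F1.Fiber x →ₗ[ℝ] E0.Fiber x :=
  𝓔.bd x ∘ₗ (q.pr x).sectionOfSurjective (q.surjective x)

theorem l1_pr (x : M) (a : E1.Fiber x) : q.l1 x (q.pr x a) = 𝓔.bd x a := by
  rw [← sub_eq_zero]
  change 𝓔.bd x _ - _ = 0
  rw [← map_sub, ← q.pr_eq_zero_iff, map_sub, LinearMap.apply_sectionOfSurjective, sub_self]

/-- The pairing induced by `S` on the quotient and `ker ρ`. -/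
def pairing (x : M) : F1.Fiber x →ₗ[ℝ] LinearMap.ker (𝓔.rho x) →ₗ[ℝ] ℝ :=
  (𝓔.S x).compl₁₂ ((q.pr x).sectionOfSurjective (q.surjective x))
    (LinearMap.ker (𝓔.rho x)).subtype

theorem pairing_pr (h𝓔 : 𝓔.IsExact) (x : M) (a : E1.Fiber x) (u : LinearMap.ker (𝓔.rho x)) :
    q.pairing x (q.pr x a) u = 𝓔.S x a u := by
  rw [← sub_eq_zero]
  change 𝓔.S x _ (u : E0.Fiber x) - _ = 0
  rw [← LinearMap.sub_apply, ← map_sub]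
  refine S_eq_zero_of_bd h𝓔 (q.pr_eq_zero_iff.1 ?_) u.2
  rw [map_sub, LinearMap.apply_sectionOfSurjective, sub_self]

/-- On the left, an `a` that annihilates ker ρ lies in im ρ* = ker ∂ and so has class zero. On the
right, every element of `E_{-1}` has a class to pair with, and nondegeneracy of `S` applies. -/
theorem pairing_nondegenerate (h𝓔 : 𝓔.IsExact) (x : M) : (q.pairing x).Nondegenerate := by
  refine ⟨fun m hm => ?_, fun u hu => ?_⟩
  · obtain ⟨a, rfl⟩ := q.surjective x m
    rw [q.pr_eq_zero_iff, ← LinearMap.mem_ker, ← h𝓔.range_rhoStar]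
    refine h𝓔.mem_range_rhoStar fun u hu => ?_
    rw [← hm ⟨u, hu⟩, q.pairing_pr h𝓔]
  · refine Subtype.ext ((𝓔.S_nondegenerate x).2 _ fun a => ?_)
    rw [← q.pairing_pr h𝓔, hu]

variable [T2Space M] [SigmaCompactSpace M]

theorem secMap_surjective : Function.Surjective q.secMap := fun m => by
  obtain ⟨a, ha⟩ := SmoothVB.exists_lift_of_surjective q.smooth q.surjective m
  exact ⟨a, (q.eq_secMap ha).symm⟩

theorem l1_smooth : IsSmoothBundleMap n F1.Model F1.Fiber E0.Model E0.Fiber q.l1 := by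
  refine SmoothVB.isSmoothBundleMap_of_sec fun m => ?_
  obtain ⟨a, rfl⟩ := q.secMap_surjective m
  simp_rw [q.secMap_apply, q.l1_pr]
  exact SmoothVB.contMDiff_apply_sec 𝓔.bd_smooth a

/-- The Lie 2-algebra of sections of the quotient. -/
def lie (h𝓔 : 𝓔.IsExact) : Lie2Algebra F1.Sec E0.Sec :=
  𝓔.leib.quotientLie q.secMap q.secMap_surjective q.secMap_eq_zero_iff 𝓔.skew
    (fun x a => h𝓔.d_l01_add_l10 a x) l3_skew_left l3_skew_right

theorem lie_d (h𝓔 : 𝓔.IsExact) (a : E1.Sec) : (q.lie h𝓔).d (q.secMap a) = 𝓔.leib.d a :=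
  𝓔.leib.quotientLie_d _ _ _ _ _ _ _ a

theorem lie_l01 (h𝓔 : 𝓔.IsExact) (e : E0.Sec) (a : E1.Sec) :
    (q.lie h𝓔).l01 e (q.secMap a) = q.secMap (𝓔.leib.l01 e a) :=
  𝓔.leib.quotientLie_l01 _ _ _ _ _ _ _ e a

theorem lie_l10 (h𝓔 : 𝓔.IsExact) (a : E1.Sec) (e : E0.Sec) :
    (q.lie h𝓔).l10 (q.secMap a) e = q.secMap (𝓔.leib.l10 a e) :=
  𝓔.leib.quotientLie_l10 _ _ _ _ _ _ _ a e

theorem lie_l01_fsmul (h𝓔 : 𝓔.IsExact) (e : E0.Sec) (m : F1.Sec) (f : C^∞⟮𝓡 n, M; ℝ⟯) (x : M) :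
    (q.lie h𝓔).l01 e (F1.fsmul f m) x
      = f x • (q.lie h𝓔).l01 e m x + differential n f x (𝓔.rho x (e x)) • m x := by
  obtain ⟨a, rfl⟩ := q.secMap_surjective m
  have h : F1.fsmul f (q.secMap a) = q.secMap (E1.fsmul f a) :=
    q.eq_secMap fun x => map_smul (q.pr x) (f x) (a x)
  rw [h, q.lie_l01, q.lie_l01, q.secMap_apply, l01_fsmul, map_add, map_smul, map_smul]
  rfl

/-- The ample Lie 2-algebroid: the quadratic Lie 2-algebroid on `F_{-1} ⊕ E_0` induced by an exact
CLWX 2-algebroid. -/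
def quadraticLie2Algebroid (h𝓔 : 𝓔.IsExact) : QuadraticLie2Algebroid F1 E0 where
  rho := 𝓔.rho
  rho_smooth := 𝓔.rho_smooth
  l1 := q.l1
  l1_smooth := q.l1_smooth
  l3 x := (q.pr x).compAlternatingMap (𝓔.Om x)
  lie := q.lie h𝓔
  lie_d m x := by
    obtain ⟨a, rfl⟩ := q.secMap_surjective m
    rw [q.lie_d, 𝓔.leib_d, q.secMap_apply, q.l1_pr]
  lie_l3 e₁ e₂ e₃ x := congrArg (q.pr x) (𝓔.leib_l3 e₁ e₂ e₃ x)
  leibniz0 := 𝓔.l00_fsmul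
  leibniz1 := q.lie_l01_fsmul h𝓔
  transitive := h𝓔.surjective
  Q := q.pairing
  Q_smooth m u hu := by
    obtain ⟨a, rfl⟩ := q.secMap_surjective m
    simp_rw [q.secMap_apply, q.pairing_pr h𝓔]
    exact 𝓔.S_smooth a u
  Q_nondegenerate := q.pairing_nondegenerate h𝓔
  Q_l1 m p x := by
    obtain ⟨a, rfl⟩ := q.secMap_surjective m
    obtain ⟨b, rfl⟩ := q.secMap_surjective p
    have h : ∀ c : E1.Fiber x, q.l1 x (q.pr x c) ∈ LinearMap.ker (𝓔.rho x) := fun c => by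
      rw [q.l1_pr]
      exact (h𝓔.exact_E0 x _).2 ⟨c, rfl⟩
    refine ⟨h _, h _, ?_⟩
    simp_rw [q.secMap_apply, q.pairing_pr h𝓔, q.l1_pr]
    exact 𝓔.bd_symm a b x
  Q_l2 e u hu m x := by
    obtain ⟨a, rfl⟩ := q.secMap_surjective m
    refine ⟨h𝓔.rho_l00 e u hu x, ?_⟩
    simp_rw [q.lie_l01, q.secMap_apply, q.pairing_pr h𝓔]
    rw [𝓔.invariant0, add_comm]
    rfl
  Q_l3 e₁ e₂ u v hu hv x := by
    simp_rw [LinearMap.compAlternatingMap_apply, q.pairing_pr h𝓔]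
    exact 𝓔.Om_skew e₁ e₂ u v x

theorem isInducedBy (h𝓔 : 𝓔.IsExact) : IsInducedBy (q.quadraticLie2Algebroid h𝓔) 𝓔 q.pr where
  rho_eq := rfl
  exists_lift := SmoothVB.exists_lift_of_surjective q.smooth q.surjective
  l1_eq m a h x := by
    rw [← h]
    exact q.l1_pr x _
  l00_eq _ _ := rfl
  l01_eq e m a h x := by
    obtain rfl := q.eq_secMap h
    exact congrArg (fun s : F1.Sec => s x) (q.lie_l01 h𝓔 e a)
  l10_eq m e a h x := by
    obtain rfl := q.eq_secMap h
    exact congrArg (fun s : F1.Sec => s x) (q.lie_l10 h𝓔 a e)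
  l3_eq _ _ _ _ := rfl
  Q_eq m a h x u := by
    rw [← h]
    exact q.pairing_pr h𝓔 x _ u

theorem isExtensionByCotangent (h𝓔 : 𝓔.IsExact) :
    IsExtensionByCotangent 𝓔 (q.quadraticLie2Algebroid h𝓔) q.pr where
  rhoStar_smooth := 𝓔.rhoStar_smooth
  pr_smooth := q.smooth
  rhoStar_injective := h𝓔.injective
  exact x := LinearMap.exact_iff.2 ((q.ker_eq x).trans (h𝓔.range_rhoStar x).symm)
  pr_surjective := q.surjective
  bd_rhoStar x α := (h𝓔.exact_E1 x _).2 ⟨α, rfl⟩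
  l1_pr := q.l1_pr

end QuotientMap

/-! ### Constant rank of ∂ and existence of the quotient bundle -/

variable {𝓔 : CLWX E1 E0}

/-- `∂` has constant rank. -/
theorem IsExact.finrank_range_bd (h𝓔 : 𝓔.IsExact) (x : M) :
    Module.finrank ℝ (LinearMap.range (𝓔.bd x)) = Module.finrank ℝ E1.Model - n := by
  have := E1.finiteDimensional_fiber x
  have h1 := LinearMap.finrank_range_add_finrank_ker (𝓔.bd x)
  have h2 : Module.finrank ℝ (E1.Fiber x) = Module.finrank ℝ E1.Model :=
    (VectorBundle.continuousLinearEquivAt ℝ E1.Model E1.Fiber x).toLinearEquiv.finrank_eq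
  have h3 : Module.finrank ℝ (CotSpace n x) = n := by
    change Module.finrank ℝ (EuclideanSpace ℝ (Fin n) →L[ℝ] ℝ) = n
    rw [← (LinearMap.toContinuousLinearMap (𝕜 := ℝ) (E := EuclideanSpace ℝ (Fin n))
      (F' := ℝ)).finrank_eq]
    exact Subspace.dual_finrank_eq.trans finrank_euclideanSpace_fin
  -- Rank–nullity with ker ∂ = im ρ* ≅ T*M of dimension `n`; the rank of ∂ plus `n` equals the rank
  -- of `E_{-1}`, so the natural subtraction does not truncate.
  rw [← h𝓔.range_rhoStar, LinearMap.finrank_range_of_inj (h𝓔.injective x), h3, h2] at h1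
  omega

theorem IsExact.nonempty_quotientBundle [T2Space M] (h𝓔 : 𝓔.IsExact) :
    Nonempty (QuotientBundle.{_, w, _, _} E1 (fun x => LinearMap.range (𝓔.rhoStar x))) := by
  have h : (fun x => LinearMap.range (𝓔.rhoStar x)) = fun x => LinearMap.ker (𝓔.bd x) :=
    funext h𝓔.range_rhoStar
  rw [h]
  -- `ULift` puts the model space in the arbitrary universe `w`.
  refine SmoothVB.nonempty_quotientBundle
    (F := ULift.{w} (EuclideanSpace ℝ (Fin (Module.finrank ℝ E1.Model - n)))) 𝓔.bd_smooth fun x => ?_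
  rw [h𝓔.finrank_range_bd, LinearEquiv.finrank_eq ULift.moduleEquiv, finrank_euclideanSpace_fin]

end CLWX

end

theorem proposition5 {n : ℕ} {M : Type*} [TopologicalSpace M] [T2Space M] [SigmaCompactSpace M]
    [ChartedSpace (EuclideanSpace ℝ (Fin n)) M] [IsManifold (𝓡 n) ∞ M]
    {E1 E0 : SmoothVB n M} (𝓔 : CLWX E1 E0) (h𝓔 : 𝓔.IsExact) :
    Nonempty (QuotientBundle E1 (fun x => LinearMap.range (𝓔.rhoStar x))) ∧
    ∀ F : QuotientBundle E1 (fun x => LinearMap.range (𝓔.rhoStar x)),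
      ∃ 𝓐 : QuadraticLie2Algebroid F.toVB E0,
        IsInducedBy 𝓐 𝓔 F.pr ∧ IsExtensionByCotangent 𝓔 𝓐 F.pr := by
  refine ⟨h𝓔.nonempty_quotientBundle, fun F => ?_⟩
  let q : CLWX.QuotientMap 𝓔 F.toVB :=
    { pr := F.pr
      smooth := F.smooth_proj
      surjective := fun x => Submodule.mkQ_surjective _
      ker_eq := fun x => (Submodule.ker_mkQ _).trans (h𝓔.range_rhoStar x) }
  exact ⟨q.quadraticLie2Algebroid h𝓔, q.isInducedBy h𝓔, q.isExtensionByCotangent h𝓔⟩
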